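/- Let $H=(V,\mathcal{E})$ be a finite $3$-uniform hypergraph with at least one hyperedge, that is, $V$ is a finite set and $\mathcal{E}$ is a non-empty finite family of $3$-element subsets of $V$ (parallel hyperedges, i.e. repeated members of the family, are allowed). The degree of a node $v\in V$ is the number of hyperedges containing $v$, counted with multiplicity. An extended matching of $H$ is a collection of pairwise disjoint subsets of $V$, each of which is either a hyperedge of $H$ or a pair $\{u,v\}$ of distinct nodes such that $u,v\in e$ for some hyperedge $e\in\mathcal{E}$. Then $H$ has an extended matching that covers every node of maximum degree, i.e. every node $v$ whose degree is the largest among all nodes of $H$ belongs to some member of the collection. -/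

import Mathlib

/-- A hypergraph with node type `V` and hyperedges indexed by `E`. Distinct indices may carry the
same node set, so parallel hyperedges are allowed; a hypergraph without parallel hyperedges is one
whose function `edge` is injective. -/
structure MultiHypergraph (V E : Type*) where
  edge : E → Finset V

namespace MultiHypergraph

variable {V E : Type*}

/-- Every hyperedge has exactly `k` nodes. -/
def IsUniform (H : MultiHypergraph V E) (k : ℕ) : Prop :=
  ∀ e, (H.edge e).card = k

/-- The degree of a node: the number of hyperedges containing it, counted with multiplicity. -/
def degree [Fintype E] [DecidableEq V] (H : MultiHypergraph V E) (v : V) : ℕ :=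
  (Finset.univ.filter fun e => v ∈ H.edge e).card

/-- A node is of maximum degree if no node has larger degree. -/
def IsMaxDegree [Fintype E] [DecidableEq V] (H : MultiHypergraph V E) (v : V) : Prop :=
  ∀ u, H.degree u ≤ H.degree v

/-- An extended matching: a collection of pairwise disjoint node sets, each of which is either a
hyperedge or a pair of two distinct nodes contained in a common hyperedge. -/
def IsExtendedMatching (H : MultiHypergraph V E) (M : Finset (Finset V)) : Prop :=
  (∀ s ∈ M, (∃ e, s = H.edge e) ∨ (s.card = 2 ∧ ∃ e, s ⊆ H.edge e)) ∧
    (M : Set (Finset V)).Pairwise Disjoint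

end MultiHypergraph

/-! Join two nodes when they share a hyperedge; the pairs in an extended matching are edges of this
graph `coGraph H`. Following Tutte–Berge, choose a set `S` and disjoint odd sets joined only to
themselves and to `S`, with the largest surplus of odd sets over `|S|` and then with `S` largest.
The odd sets are then factor-critical and, together with `S`, cover all nodes
(`exists_max_barrier`). A factor-critical set `K` can be handled by matching one of its nodes to
`S`. It needs no help if it has a node outside `T`, the set to be covered, or contains a hyperedge
whose deletion leaves a matchable set; otherwise it is bad. By Hall's theorem it remains to bound
every family of bad sets by the number of its neighbours in `S`.

This is a count. Let `cost H K` be the number of incidences outside `K` of hyperedges meeting `K`.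
Over a family, these incidences all lie on its neighbours, so their number is at most `Δ` times the
number of neighbours (`sum_cost_le`). It suffices that a bad set costs at least `Δ`
(`le_cost_of_isBad`). Call a triangle flat in `K` if deleting it leaves an unmatchable set. Suppose
`K` carries integer weights at most 1, of total at least 2, nonpositive on flat triangles. Then `2Δ`
is at most the degree sum weighted by `y`. Regroup this sum by hyperedges: one inside `K` is flat
and contributes at most 0, and one with `i = 1` or `2` nodes in `K` contributes at most `i ≤ 2(3 -
i)`. So `2Δ ≤ 2 * cost H K`.

The weight (`FactorCritical.exists_weight`) is constantly 1 if there is no flat triangle. Otherwise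
Tutte's theorem gives a barrier, from which `exists_isEnd` extracts either an end with exactly two
attachments or two ends with at least three attachments each. Weights on smaller factor-critical
sets (`extension` on an end, `collapse` beyond it) are then combined. Combining them requires
control at the attachments, so the induction runs on the stronger `RootedWeight`. -/

namespace ExtendedMatching

open Finset

set_option linter.unusedSectionVars false

/-! ### Matchings and factor-critical sets. -/

section graph

variable {V : Type*} [DecidableEq V] {G G' : SimpleGraph V}

/-- The map `f` restricts to a perfect matching of the graph induced on `U`. -/
def MatchedBy (G : SimpleGraph V) (f : V → V) (U : Finset V) : Prop :=
  ∀ u ∈ U, f u ∈ U ∧ G.Adj u (f u) ∧ f (f u) = u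

/-- The graph induced on `U` has a perfect matching. -/
def Matchable (G : SimpleGraph V) (U : Finset V) : Prop :=
  ∃ f : V → V, MatchedBy G f U

/-- The graph induced on `U` is factor-critical. -/
def FactorCritical (G : SimpleGraph V) (U : Finset V) : Prop :=
  U.Nonempty ∧ ∀ v ∈ U, Matchable G (U.erase v)

lemma matchable_empty : Matchable G ∅ := ⟨id, by simp [MatchedBy]⟩

lemma matchable_pair {a b : V} (h : G.Adj a b) : Matchable G {a, b} := by
  refine ⟨fun v => if v = a then b else a, ?_⟩
  intro u hu
  have hne := h.ne
  simp only [mem_insert, mem_singleton] at hu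
  rcases hu with rfl | rfl
  · simp [h, hne.symm]
  · simp [h.symm, hne.symm]

lemma Matchable.union {A B : Finset V} (hA : Matchable G A) (hB : Matchable G B)
    (hd : Disjoint A B) : Matchable G (A ∪ B) := by
  obtain ⟨f, hf⟩ := hA
  obtain ⟨g, hg⟩ := hB
  refine ⟨fun v => if v ∈ A then f v else g v, ?_⟩
  intro u hu
  by_cases hu' : u ∈ A
  · obtain ⟨h1, h2, h3⟩ := hf u hu'
    simp [hu', h1, h2, h3]
  · have huB : u ∈ B := by simpa [hu'] using hu
    obtain ⟨h1, h2, h3⟩ := hg u huB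
    have : g u ∉ A := fun h => (disjoint_left.1 hd h) h1
    simp [hu', h1, h2, h3, this]

lemma Matchable.biUnion {ι : Type*} {s : Finset ι} {t : ι → Finset V}
    (h : ∀ i ∈ s, Matchable G (t i)) (hd : (s : Set ι).PairwiseDisjoint t) :
    Matchable G (s.biUnion t) := by
  classical
  induction s using Finset.induction_on with
  | empty => simpa using matchable_empty
  | insert i s hi ih =>
    rw [biUnion_insert]
    refine (h i (by simp)).union (ih (fun k hk => h k (by simp [hk]))
      (hd.subset (by simp))) ?_
    rw [disjoint_biUnion_right]
    intro k hk
    exact hd (by simp) (by simp [hk]) (by rintro rfl; exact hi hk)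

lemma Matchable.mono {U : Finset V} (h : Matchable G U)
    (hG : ∀ u ∈ U, ∀ v ∈ U, G.Adj u v → G'.Adj u v) : Matchable G' U := by
  obtain ⟨f, hf⟩ := h
  exact ⟨f, fun u hu => ⟨(hf u hu).1, hG u hu _ (hf u hu).1 (hf u hu).2.1, (hf u hu).2.2⟩⟩

/-- `f` is a fixed-point-free involution of `U`, so the ones summed over `U` cancel in pairs modulo
2. -/
lemma MatchedBy.even_card {f : V → V} {U : Finset V} (h : MatchedBy G f U) : Even U.card := by
  have h0 : ∑ _u ∈ U, (1 : ZMod 2) = 0 := by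
    refine Finset.sum_involution (fun a _ => f a) ?_ ?_ ?_ ?_
    · intro a _; decide
    · intro a ha _; exact (h a ha).2.1.ne'
    · intro a ha; exact (h a ha).1
    · intro a ha; exact (h a ha).2.2
  rw [sum_const, nsmul_eq_mul, mul_one] at h0
  exact (ZMod.natCast_eq_zero_iff_even).1 h0

lemma Matchable.even_card {U : Finset V} (h : Matchable G U) : Even U.card := by
  obtain ⟨f, hf⟩ := h
  exact hf.even_card

lemma MatchedBy.subset {f : V → V} {U A : Finset V} (h : MatchedBy G f U) (hA : A ⊆ U)
    (hinv : ∀ a ∈ A, f a ∈ A) : MatchedBy G f A :=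
  fun a ha => ⟨hinv a ha, (h a (hA ha)).2⟩

lemma MatchedBy.sdiff {f : V → V} {U A : Finset V} (h : MatchedBy G f U)
    (hinv : ∀ a ∈ A, f a ∈ A) : MatchedBy G f (U \ A) := by
  refine h.subset sdiff_subset ?_
  intro v hv
  rw [mem_sdiff] at hv ⊢
  refine ⟨(h v hv.1).1, fun hfv => hv.2 ?_⟩
  have := hinv _ hfv
  rwa [(h v hv.1).2.2] at this

/-- A matching of `insert x U` pairs `x` with a neighbour and matches the remainder. -/
lemma Matchable.exists_partner {x : V} {U : Finset V} (h : Matchable G U) (hx : x ∈ U) :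
    ∃ u ∈ U, G.Adj x u ∧ Matchable G (U \ {x, u}) := by
  obtain ⟨f, hf⟩ := h
  obtain ⟨h1, h2, h3⟩ := hf x hx
  refine ⟨f x, h1, h2, f, hf.sdiff ?_⟩
  intro a ha
  simp only [mem_insert, mem_singleton] at ha ⊢
  rcases ha with rfl | rfl
  · simp
  · simp [h3]

lemma FactorCritical.odd_card {U : Finset V} (h : FactorCritical G U) : Odd U.card := by
  obtain ⟨v, hv⟩ := h.1
  have := (h.2 v hv).even_card
  rw [card_erase_of_mem hv] at this
  have hpos := card_pos.2 h.1
  obtain ⟨k, hk⟩ := this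
  exact ⟨k, by omega⟩

/-- Adding an adjacent outer vertex to a factor-critical set gives a matchable set. -/
lemma FactorCritical.matchable_insert {K : Finset V} (h : FactorCritical G K) {x k : V}
    (hx : x ∉ K) (hk : k ∈ K) (hadj : G.Adj x k) : Matchable G (insert x K) := by
  have := (matchable_pair hadj).union (h.2 k hk) (by
    rw [disjoint_left]; intro a ha; simp only [mem_insert, mem_singleton] at ha
    rcases ha with rfl | rfl <;> simp [hx])
  convert this using 1
  ext a
  simp only [mem_insert, mem_union, mem_singleton, mem_erase]
  by_cases hak : a = k <;> simp [hak, hk]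

/-! ### Barriers. -/

/-- A family `𝒦` of pairwise disjoint odd subsets of `C \ S`, each joined within `C` only to
itself and to `S`. -/
structure Barrier (G : SimpleGraph V) (C S : Finset V) (𝒦 : Finset (Finset V)) : Prop where
  subset : S ⊆ C
  sub : ∀ K ∈ 𝒦, K ⊆ C
  notMem : ∀ K ∈ 𝒦, ∀ k ∈ K, k ∉ S
  odd : ∀ K ∈ 𝒦, Odd K.card
  disj : ∀ K ∈ 𝒦, ∀ L ∈ 𝒦, ∀ v ∈ K, v ∈ L → K = L
  closed : ∀ K ∈ 𝒦, ∀ k ∈ K, ∀ v ∈ C, G.Adj k v → v ∈ K ∨ v ∈ S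

lemma Barrier.nonempty {C S : Finset V} {𝒦 : Finset (Finset V)} (h : Barrier G C S 𝒦)
    {K : Finset V} (hK : K ∈ 𝒦) : K.Nonempty := by
  rw [← card_pos]
  exact (h.odd K hK).pos

/-- An odd set cannot be matched within itself, and a partner outside `K` must lie in `S`. -/
lemma Barrier.exists_crossing {C S : Finset V} {𝒦 : Finset (Finset V)} (h : Barrier G C S 𝒦)
    {f : V → V} (hf : MatchedBy G f C) {K : Finset V} (hK : K ∈ 𝒦) : ∃ k ∈ K, f k ∈ S := by
  by_contra hcon
  push Not at hcon
  have : MatchedBy G f K := hf.subset (h.sub K hK) (fun a ha => by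
    obtain ⟨h1, h2, _⟩ := hf a (h.sub K hK ha)
    exact (h.closed K hK a ha _ h1 h2).resolve_right (hcon a ha))
  exact (Nat.not_even_iff_odd.2 (h.odd K hK)) this.even_card

lemma Barrier.exists_injection {C S : Finset V} {𝒦 : Finset (Finset V)} (h : Barrier G C S 𝒦)
    (h𝒦 : 𝒦.Nonempty) {f : V → V} (hf : MatchedBy G f C) :
    ∃ φ : Finset V → V, (∀ K ∈ 𝒦, φ K ∈ S ∧ f (φ K) ∈ K) ∧ Set.InjOn φ 𝒦 := by
  have : ∀ K : Finset V, ∃ s, K ∈ 𝒦 → s ∈ S ∧ f s ∈ K := by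
    intro K
    by_cases hK : K ∈ 𝒦
    · obtain ⟨k, hk, hks⟩ := h.exists_crossing hf hK
      exact ⟨f k, fun _ => ⟨hks, by rwa [(hf k (h.sub K hK hk)).2.2]⟩⟩
    · obtain ⟨L, hL⟩ := h𝒦
      obtain ⟨v, -⟩ := h.nonempty hL
      exact ⟨v, fun h => absurd h hK⟩
  choose φ hφ using this
  refine ⟨φ, fun K hK => hφ K hK, ?_⟩
  intro K hK L hL hKL
  refine h.disj K hK L hL _ (hφ K hK).2 ?_
  rw [hKL]; exact (hφ L hL).2

lemma Barrier.card_le {C S : Finset V} {𝒦 : Finset (Finset V)} (h : Barrier G C S 𝒦)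
    (hC : Matchable G C) : 𝒦.card ≤ S.card := by
  obtain rfl | hne := 𝒦.eq_empty_or_nonempty
  · simp
  obtain ⟨f, hf⟩ := hC
  obtain ⟨φ, h1, h2⟩ := h.exists_injection hne hf
  exact card_le_card_of_injOn φ (fun K hK => (h1 K hK).1) h2

/-- In a tight barrier of a matchable set, each member is matched through one vertex of `S`,
and the remaining vertices are matched among themselves. -/
lemma Barrier.tight {C S : Finset V} {𝒦 : Finset (Finset V)} (h : Barrier G C S 𝒦)
    (hC : Matchable G C) (hcard : S.card ≤ 𝒦.card) :
    (∀ K ∈ 𝒦, ∃ s ∈ S, Matchable G (insert s K)) ∧ Matchable G (C \ (S ∪ 𝒦.biUnion id)) := by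
  obtain rfl | hne := 𝒦.eq_empty_or_nonempty
  · obtain rfl : S = ∅ := by simpa using hcard
    simpa using hC
  obtain ⟨f, hf⟩ := hC
  obtain ⟨φ, h1, h2⟩ := h.exists_injection hne hf
  -- Tightness makes the injection onto `S`, so each member has exactly one matching edge leaving it
  -- and no vertex of `S` is matched elsewhere.
  have hsurj : ∀ s ∈ S, ∃ K ∈ 𝒦, φ K = s :=
    Finset.surjOn_of_injOn_of_card_le φ (fun K hK => (h1 K hK).1) h2 hcard
  have key : ∀ K ∈ 𝒦, ∀ k ∈ K, f k ∈ K ∨ f k = φ K := by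
    intro K hK k hk
    obtain ⟨h3, h4, h5⟩ := hf k (h.sub K hK hk)
    refine (h.closed K hK k hk _ h3 h4).imp id fun hS => ?_
    obtain ⟨L, hL, hLs⟩ := hsurj _ hS
    have := (h1 L hL).2
    rw [hLs, h5] at this
    rw [← hLs, h.disj K hK L hL k hk this]
  refine ⟨fun K hK => ⟨φ K, (h1 K hK).1, f, hf.subset ?_ ?_⟩, f, hf.sdiff ?_⟩
  · intro v hv
    rcases mem_insert.1 hv with rfl | hv
    · exact h.subset (h1 K hK).1
    · exact h.sub K hK hv
  · intro v hv
    rcases mem_insert.1 hv with rfl | hv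
    · exact mem_insert_of_mem (h1 K hK).2
    · rcases key K hK v hv with h3 | h3 <;> simp [h3]
  · intro v hv
    rw [mem_union, mem_biUnion] at hv ⊢
    rcases hv with hv | ⟨K, hK, hv⟩
    · obtain ⟨K, hK, rfl⟩ := hsurj v hv
      exact Or.inr ⟨K, hK, (h1 K hK).2⟩
    · rcases key K hK v hv with h3 | h3
      · exact Or.inr ⟨K, hK, h3⟩
      · exact Or.inl (h3 ▸ (h1 K hK).1)

lemma exists_maximal_of_bounded {α : Type*} {P : α → Prop} (f : α → ℕ) (N : ℕ)
    (hN : ∀ a, P a → f a ≤ N) (h : ∃ a, P a) : ∃ a, P a ∧ ∀ b, P b → f b ≤ f a := by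
  obtain ⟨a, ha, hmin⟩ := (measure fun a => N - f a).wf.has_min {a | P a} h
  refine ⟨a, ha, fun b hb => ?_⟩
  have h1 := hmin b hb
  have h2 := hN a ha
  have h3 := hN b hb
  change ¬ (N - f b < N - f a) at h1
  omega

lemma exists_minimal_measure {α : Type*} {P : α → Prop} (f : α → ℕ)
    (h : ∃ a, P a) : ∃ a, P a ∧ ∀ b, P b → f a ≤ f b := by
  obtain ⟨a, ha, hmin⟩ := (measure f).wf.has_min {a | P a} h
  exact ⟨a, ha, fun b hb => not_lt.1 (hmin b hb)⟩

open Classical in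
/-- The vertices of `S` adjacent to a member of `𝒦`. -/
noncomputable def nbr (G : SimpleGraph V) (S : Finset V) (𝒦 : Finset (Finset V)) : Finset V :=
  S.filter fun s => ∃ K ∈ 𝒦, ∃ k ∈ K, G.Adj s k

lemma mem_nbr {S : Finset V} {𝒦 : Finset (Finset V)} {s : V} :
    s ∈ nbr G S 𝒦 ↔ s ∈ S ∧ ∃ K ∈ 𝒦, ∃ k ∈ K, G.Adj s k := by
  simp [nbr]

lemma nbr_subset {S : Finset V} {𝒦 : Finset (Finset V)} : nbr G S 𝒦 ⊆ S := by
  intro s hs; exact (mem_nbr.1 hs).1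

lemma nbr_mono {S : Finset V} {𝒦 𝒦' : Finset (Finset V)} (h : 𝒦' ⊆ 𝒦) :
    nbr G S 𝒦' ⊆ nbr G S 𝒦 := by
  intro s hs
  obtain ⟨h1, K, hK, h2⟩ := mem_nbr.1 hs
  exact mem_nbr.2 ⟨h1, K, h hK, h2⟩

lemma barrier_empty {C : Finset V} : Barrier G C ∅ ∅ := by
  constructor <;> simp

namespace Barrier

variable {C S : Finset V} {𝒦 : Finset (Finset V)}

/-- A subfamily is already separated by its own neighbours. Thus a bound valid for all barriers
becomes a Hall condition for subfamilies. -/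
lemma restrict (h : Barrier G C S 𝒦) {𝒦' : Finset (Finset V)} (h𝒦 : 𝒦' ⊆ 𝒦) :
    Barrier G C (nbr G S 𝒦') 𝒦' where
  subset := nbr_subset.trans h.subset
  sub K hK := h.sub K (h𝒦 hK)
  notMem K hK k hk hs := h.notMem K (h𝒦 hK) k hk (nbr_subset hs)
  odd K hK := h.odd K (h𝒦 hK)
  disj K hK L hL := h.disj K (h𝒦 hK) L (h𝒦 hL)
  closed K hK k hk v hv hadj := (h.closed K (h𝒦 hK) k hk v hv hadj).imp id fun hs =>
    mem_nbr.2 ⟨hs, K, hK, k, hk, hadj.symm⟩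

lemma enlarge (h : Barrier G C S 𝒦) {S' : Finset V} (hS : S ⊆ S') (hC : S' ⊆ C)
    (hn : ∀ K ∈ 𝒦, ∀ k ∈ K, k ∉ S') : Barrier G C S' 𝒦 where
  subset := hC
  sub := h.sub
  notMem := hn
  odd := h.odd
  disj := h.disj
  closed K hK k hk v hv hadj := (h.closed K hK k hk v hv hadj).imp id fun hs => hS hs

/-- Passing to a smaller ambient set containing all members. -/
lemma ambient (h : Barrier G C S 𝒦) {C' : Finset V} (hC : C' ⊆ C)
    (hK : ∀ K ∈ 𝒦, K ⊆ C') : Barrier G C' (S ∩ C') 𝒦 where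
  subset := inter_subset_right
  sub := hK
  notMem K hK k hk hs := h.notMem K hK k hk (mem_inter.1 hs).1
  odd := h.odd
  disj := h.disj
  closed K hK k hk v hv hadj := (h.closed K hK k hk v (hC hv) hadj).imp id fun hs =>
    mem_inter.2 ⟨hs, hv⟩

/-- The vertices of the ambient set outside a barrier. -/
def rest (C S : Finset V) (𝒦 : Finset (Finset V)) : Finset V := C \ (S ∪ 𝒦.biUnion id)

lemma mem_rest {v : V} : v ∈ rest C S 𝒦 ↔ v ∈ C ∧ v ∉ S ∧ ∀ K ∈ 𝒦, v ∉ K := by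
  simp [rest]

/-- No member is adjacent to the remainder, so an odd remainder serves as a further member at no
cost in `S`. -/
lemma add_rest (h : Barrier G C S 𝒦) (hodd : Odd (rest C S 𝒦).card) :
    Barrier G C S (insert (rest C S 𝒦) 𝒦) := by
  have hcl : ∀ k ∈ rest C S 𝒦, ∀ v ∈ C, G.Adj k v → v ∈ rest C S 𝒦 ∨ v ∈ S := by
    intro k hk v hv hadj
    rw [mem_rest] at hk ⊢
    by_cases hvS : v ∈ S
    · exact Or.inr hvS
    · refine Or.inl ⟨hv, hvS, fun K hK hvK => ?_⟩
      rcases h.closed K hK v hvK k hk.1 hadj.symm with h1 | h1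
      · exact hk.2.2 K hK h1
      · exact hk.2.1 h1
  constructor
  · exact h.subset
  · intro K hK
    rcases mem_insert.1 hK with rfl | hK
    · exact sdiff_subset
    · exact h.sub K hK
  · intro K hK
    rcases mem_insert.1 hK with rfl | hK
    · intro k hk; exact (mem_rest.1 hk).2.1
    · exact h.notMem K hK
  · intro K hK
    rcases mem_insert.1 hK with rfl | hK
    · exact hodd
    · exact h.odd K hK
  · intro K hK L hL v hvK hvL
    rcases mem_insert.1 hK with rfl | hK <;> rcases mem_insert.1 hL with rfl | hL
    · rfl
    · exact absurd hvL ((mem_rest.1 hvK).2.2 L hL)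
    · exact absurd hvK ((mem_rest.1 hvL).2.2 K hK)
    · exact h.disj K hK L hL v hvK hvL
  · intro K hK
    rcases mem_insert.1 hK with rfl | hK
    · exact hcl
    · exact h.closed K hK

lemma card_add_rest (hodd : Odd (rest C S 𝒦).card) :
    (insert (rest C S 𝒦) 𝒦).card = 𝒦.card + 1 := by
  refine card_insert_of_notMem fun hmem => ?_
  obtain ⟨v, hv⟩ := card_pos.1 hodd.pos
  exact (mem_rest.1 hv).2.2 _ hmem hv

lemma pairwiseDisjoint (h : Barrier G C S 𝒦) : (𝒦 : Set (Finset V)).PairwiseDisjoint id := by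
  intro K hK L hL hne
  rw [Function.onFun, disjoint_left]
  intro v hvK hvL
  exact hne (h.disj K hK L hL v hvK hvL)

lemma disjoint_biUnion (h : Barrier G C S 𝒦) : Disjoint S (𝒦.biUnion id) := by
  rw [disjoint_left]
  intro v hv hv'
  obtain ⟨K, hK, hvK⟩ := mem_biUnion.1 hv'
  exact h.notMem K hK v hvK hv

/-- `S`, the members and the remainder partition `C`, and the members are odd. This parity decides
when `add_rest` applies. -/
lemma even_card_add (h : Barrier G C S 𝒦) :
    Even (C.card + S.card + 𝒦.card + (rest C S 𝒦).card) := by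
  have h1 : (𝒦.biUnion id).card = ∑ K ∈ 𝒦, K.card := card_biUnion h.pairwiseDisjoint
  have h2 : (S ∪ 𝒦.biUnion id).card = S.card + (𝒦.biUnion id).card :=
    card_union_of_disjoint h.disjoint_biUnion
  have h3 : (rest C S 𝒦).card + (S ∪ 𝒦.biUnion id).card = C.card := by
    refine card_sdiff_add_card_eq_card (union_subset h.subset ?_)
    exact biUnion_subset.2 fun K hK => h.sub K hK
  have h4 : Even (∑ K ∈ 𝒦, K.card + 𝒦.card) := by
    rw [card_eq_sum_ones 𝒦, ← sum_add_distrib]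
    exact even_sum _ fun K hK => (h.odd K hK).add_one
  obtain ⟨a, ha⟩ := h4
  exact ⟨S.card + (rest C S 𝒦).card + a, by omega⟩

/-- Replacing a member `K` by a barrier of `K.erase k`. -/
lemma refine (h : Barrier G C S 𝒦) {K : Finset V} (hK : K ∈ 𝒦) {k : V} (hk : k ∈ K)
    {S' : Finset V} {𝒦' : Finset (Finset V)} (h' : Barrier G (K.erase k) S' 𝒦') :
    Barrier G C (insert k (S ∪ S')) (𝒦.erase K ∪ 𝒦') := by
  have hS'K : ∀ s ∈ S', s ∈ K ∧ s ≠ k := fun s hs => by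
    have := h'.subset hs; rw [mem_erase] at this; exact this.symm
  have hL'K : ∀ L ∈ 𝒦', ∀ l ∈ L, l ∈ K ∧ l ≠ k := fun L hL l hl => by
    have := h'.sub L hL hl; rw [mem_erase] at this; exact this.symm
  constructor
  · intro v hv
    simp only [mem_insert, mem_union] at hv
    rcases hv with rfl | hv | hv
    · exact h.sub K hK hk
    · exact h.subset hv
    · exact h.sub K hK (hS'K v hv).1
  · intro L hL
    rcases mem_union.1 hL with hL | hL
    · exact h.sub L (mem_erase.1 hL).2
    · exact fun l hl => h.sub K hK (hL'K L hL l hl).1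
  · intro L hL l hl hmem
    simp only [mem_insert, mem_union] at hmem
    rcases mem_union.1 hL with hL | hL
    · obtain ⟨hne, hL⟩ := mem_erase.1 hL
      have hlK : l ∉ K := fun hlK => hne (h.disj L hL K hK l hl hlK)
      rcases hmem with rfl | hmem | hmem
      · exact hlK hk
      · exact h.notMem L hL l hl hmem
      · exact hlK (hS'K l hmem).1
    · rcases hmem with rfl | hmem | hmem
      · exact (hL'K L hL l hl).2 rfl
      · exact h.notMem K hK l (hL'K L hL l hl).1 hmem
      · exact h'.notMem L hL l hl hmem
  · intro L hL
    rcases mem_union.1 hL with hL | hL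
    · exact h.odd L (mem_erase.1 hL).2
    · exact h'.odd L hL
  · intro L hL M hM v hvL hvM
    rcases mem_union.1 hL with hL | hL <;> rcases mem_union.1 hM with hM | hM
    · exact h.disj L (mem_erase.1 hL).2 M (mem_erase.1 hM).2 v hvL hvM
    · exact absurd (h.disj L (mem_erase.1 hL).2 K hK v hvL (hL'K M hM v hvM).1) (mem_erase.1 hL).1
    · exact absurd (h.disj M (mem_erase.1 hM).2 K hK v hvM (hL'K L hL v hvL).1) (mem_erase.1 hM).1
    · exact h'.disj L hL M hM v hvL hvM
  · intro L hL l hl v hv hadj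
    simp only [mem_insert, mem_union]
    rcases mem_union.1 hL with hL | hL
    · rcases h.closed L (mem_erase.1 hL).2 l hl v hv hadj with h1 | h1 <;> tauto
    · by_cases hvk : v = k
      · tauto
      rcases h.closed K hK l (hL'K L hL l hl).1 v hv hadj with h1 | h1
      · rcases h'.closed L hL l hl v (mem_erase.2 ⟨hvk, h1⟩) hadj with h1 | h1 <;> tauto
      · tauto

lemma card_refine_left (h : Barrier G C S 𝒦) {K : Finset V} (hK : K ∈ 𝒦) {k : V} (hk : k ∈ K)
    {S' : Finset V} {𝒦' : Finset (Finset V)} (h' : Barrier G (K.erase k) S' 𝒦') :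
    (insert k (S ∪ S')).card = S.card + S'.card + 1 := by
  have hS'K : ∀ s ∈ S', s ∈ K ∧ s ≠ k := fun s hs => by
    have := h'.subset hs; rw [mem_erase] at this; exact this.symm
  rw [card_insert_of_notMem, card_union_of_disjoint]
  · rw [disjoint_left]
    intro s hs hs'
    exact h.notMem K hK s (hS'K s hs').1 hs
  · rw [mem_union]
    rintro (h1 | h1)
    · exact h.notMem K hK k hk h1
    · exact (hS'K k h1).2 rfl

lemma card_refine_right (h : Barrier G C S 𝒦) {K : Finset V} (hK : K ∈ 𝒦) {k : V}
    {S' : Finset V} {𝒦' : Finset (Finset V)} (h' : Barrier G (K.erase k) S' 𝒦') :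
    (𝒦.erase K ∪ 𝒦').card + 1 = 𝒦.card + 𝒦'.card := by
  rw [card_union_of_disjoint, ← card_erase_add_one hK]
  · omega
  · rw [disjoint_left]
    intro L hL hL'
    obtain ⟨v, hv⟩ := h'.nonempty hL'
    exact (mem_erase.1 hL).1 (h.disj L (mem_erase.1 hL).2 K hK v hv
      (mem_erase.1 (h'.sub L hL' hv)).2)

end Barrier

/-! ### Hall's condition and Tutte's theorem. -/

/-- Hall's condition lets a family of factor-critical sets be matched through distinct
representatives. -/
lemma matchable_of_hall {S : Finset V} {𝒦 : Finset (Finset V)}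
    (hFC : ∀ K ∈ 𝒦, FactorCritical G K) (hd : (𝒦 : Set (Finset V)).PairwiseDisjoint id)
    (hn : ∀ K ∈ 𝒦, ∀ k ∈ K, k ∉ S) (hcard : S.card ≤ 𝒦.card)
    (hall : ∀ 𝒦' ⊆ 𝒦, 𝒦'.card ≤ (nbr G S 𝒦').card) : Matchable G (S ∪ 𝒦.biUnion id) := by
  classical
  have := (Finset.all_card_le_biUnion_card_iff_exists_injective
    (fun K : {K // K ∈ 𝒦} => nbr G S {K.1})).1 (by
      intro s
      have h1 := hall (s.map (Function.Embedding.subtype _)) (by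
        intro K hK
        obtain ⟨L, -, rfl⟩ := mem_map.1 hK
        exact L.2)
      rw [card_map] at h1
      refine h1.trans (card_le_card ?_)
      intro v hv
      obtain ⟨hvS, K, hK, k, hk, hadj⟩ := mem_nbr.1 hv
      obtain ⟨L, hL, rfl⟩ := mem_map.1 hK
      exact mem_biUnion.2 ⟨L, hL, mem_nbr.2 ⟨hvS, L, mem_singleton_self _, k, hk, hadj⟩⟩)
  obtain ⟨φ, hφ, hφ'⟩ := this
  have himg : 𝒦.attach.image φ = S := by
    refine eq_of_subset_of_card_le ?_ ?_
    · intro s hs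
      obtain ⟨K, -, rfl⟩ := mem_image.1 hs
      exact nbr_subset (hφ' K)
    · rw [card_image_of_injective _ hφ, card_attach]
      exact hcard
  have key : Matchable G (𝒦.attach.biUnion fun K => insert (φ K) K.1) := by
    refine Matchable.biUnion ?_ ?_
    · intro K _
      obtain ⟨hs, L, hL, k, hk, hadj⟩ := mem_nbr.1 (hφ' K)
      rw [mem_singleton.1 hL] at hk
      exact (hFC K.1 K.2).matchable_insert (fun hmem => hn _ K.2 _ hmem hs) hk hadj
    · intro K _ L _ hne
      have hKL := hd K.2 L.2 (fun h => hne (Subtype.ext h))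
      rw [Function.onFun, disjoint_left] at hKL ⊢
      intro v hvK hvL
      rcases mem_insert.1 hvK with rfl | hvK <;> rcases mem_insert.1 hvL with h1 | hvL
      · exact hne (hφ h1)
      · exact hn _ L.2 _ hvL (nbr_subset (hφ' K))
      · subst h1; exact hn _ K.2 _ hvK (nbr_subset (hφ' L))
      · exact hKL hvK hvL
  convert key using 1
  ext v
  simp only [mem_union, mem_biUnion, mem_attach, true_and, mem_insert, id, Subtype.exists]
  rw [← himg, mem_image]
  constructor
  · rintro (⟨K, -, rfl⟩ | ⟨K, hK, hv⟩)
    · exact ⟨K.1, K.2, Or.inl rfl⟩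
    · exact ⟨K, hK, Or.inr hv⟩
  · rintro ⟨K, hK, rfl | hv⟩
    · exact Or.inl ⟨⟨K, hK⟩, by simp, rfl⟩
    · exact Or.inr ⟨K, hK, hv⟩

/-- Tutte's theorem, in terms of barriers. -/
theorem exists_barrier_of_not_matchable (U : Finset V) (heven : Even U.card)
    (hU : ¬ Matchable G U) : ∃ S 𝒦, Barrier G U S 𝒦 ∧ S.card + 2 ≤ 𝒦.card := by
  induction hn : U.card using Nat.strong_induction_on generalizing U with
  | _ n ih =>
  subst hn
  by_contra hcon
  push Not at hcon
  -- Since `U` is even, surplus one forces an odd remainder, and adding it as a member gives surplus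
  -- two.
  have hle : ∀ S 𝒦, Barrier G U S 𝒦 → 𝒦.card ≤ S.card := by
    intro S 𝒦 h
    have h1 := hcon S 𝒦 h
    by_contra hlt
    have hodd : Odd (Barrier.rest U S 𝒦).card := by
      have := h.even_card_add
      rw [← Nat.not_even_iff_odd]
      intro hev
      obtain ⟨a, ha⟩ := this; obtain ⟨b, hb⟩ := hev; obtain ⟨c, hc⟩ := heven
      omega
    have h2 := hcon _ _ (h.add_rest hodd)
    rw [Barrier.card_add_rest hodd] at h2
    omega
  obtain ⟨⟨S, 𝒦⟩, ⟨hB, heq⟩, hmax⟩ := exists_maximal_of_bounded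
    (P := fun p : Finset V × Finset (Finset V) => Barrier G U p.1 p.2 ∧ p.2.card = p.1.card)
    (fun p => p.1.card) U.card (fun p hp => card_le_card hp.1.subset)
    ⟨(∅, ∅), barrier_empty, rfl⟩
  simp only at hB heq
  have hmax' : ∀ S' 𝒦', Barrier G U S' 𝒦' → 𝒦'.card = S'.card → S'.card ≤ S.card :=
    fun S' 𝒦' h1 h2 => hmax (S', 𝒦') ⟨h1, h2⟩
  -- Moving one vertex of the remainder into `S` leaves an odd remainder; adding that as a member
  -- gives a tight barrier with larger `S`.
  have hrest : Barrier.rest U S 𝒦 = ∅ := by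
    by_contra hne
    obtain ⟨v, hv⟩ := nonempty_iff_ne_empty.2 hne
    obtain ⟨hvU, hvS, hvK⟩ := Barrier.mem_rest.1 hv
    have hB' : Barrier G U (insert v S) 𝒦 := hB.enlarge (subset_insert _ _)
      (insert_subset hvU hB.subset) (by
        intro K hK k hk hmem
        rcases mem_insert.1 hmem with rfl | hmem
        · exact hvK K hK hk
        · exact hB.notMem K hK k hk hmem)
    have hodd : Odd (Barrier.rest U (insert v S) 𝒦).card := by
      have h1 := hB'.even_card_add
      rw [card_insert_of_notMem hvS] at h1
      rw [← Nat.not_even_iff_odd]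
      intro hev
      obtain ⟨a, ha⟩ := h1; obtain ⟨b, hb⟩ := hev; obtain ⟨c, hc⟩ := heven
      omega
    have := hmax' _ _ (hB'.add_rest hodd) (by
      rw [Barrier.card_add_rest hodd, card_insert_of_notMem hvS, heq])
    rw [card_insert_of_notMem hvS] at this
    omega
  -- If `K.erase k` were unmatchable, its barrier of surplus at least two would replace `K`. This
  -- costs one member and puts `k` into `S`, so the surplus does not drop while `S` grows.
  have hFC : ∀ K ∈ 𝒦, FactorCritical G K := by
    intro K hK
    refine ⟨hB.nonempty hK, fun k hk => ?_⟩
    by_contra hnm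
    have hlt : (K.erase k).card < U.card :=
      (card_erase_lt_of_mem hk).trans_le (card_le_card (hB.sub K hK))
    have hev : Even (K.erase k).card := by
      obtain ⟨a, ha⟩ := hB.odd K hK
      rw [card_erase_of_mem hk]; exact ⟨a, by omega⟩
    obtain ⟨S', 𝒦', h', hc⟩ := ih _ hlt _ hev hnm rfl
    have h1 := hB.refine hK hk h'
    have h2 := hB.card_refine_left hK hk h'
    have h3 := hB.card_refine_right hK h'
    have h4 := hle _ _ h1
    have h5 := hmax' _ _ h1 (by omega)
    omega
  apply hU
  have := matchable_of_hall hFC hB.pairwiseDisjoint hB.notMem heq.ge (fun 𝒦' h𝒦' =>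
    hle _ _ (hB.restrict h𝒦'))
  convert this using 1
  refine Subset.antisymm ?_ (union_subset hB.subset (biUnion_subset.2 hB.sub))
  exact sdiff_eq_empty_iff_subset.1 hrest

/-! ### Ends of a factor-critical set. -/

/-- A factor-critical set `K` attached to the rest of `C` only through `X`, such that
`C \ K` is matchable, also after the deletion of any two vertices of `X`. -/
structure IsEnd (G : SimpleGraph V) (C K X : Finset V) : Prop where
  sub : K ⊆ C
  subset : X ⊆ C
  notMem : ∀ x ∈ X, x ∉ K
  fc : FactorCritical G K
  closed : ∀ k ∈ K, ∀ v ∈ C, G.Adj k v → v ∈ K ∨ v ∈ X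
  matchable : Matchable G (C \ K)
  matchable_pair : ∀ x ∈ X, ∀ x' ∈ X, x ≠ x' → Matchable G ((C \ K) \ {x, x'})

lemma Barrier.lift {C S T : Finset V} {𝒦 : Finset (Finset V)} (h : Barrier G (C \ T) S 𝒦)
    (hT : T ⊆ C) : Barrier G C (S ∪ T) 𝒦 where
  subset := union_subset (h.subset.trans sdiff_subset) hT
  sub K hK := (h.sub K hK).trans sdiff_subset
  notMem K hK k hk hmem := by
    rcases mem_union.1 hmem with h1 | h1
    · exact h.notMem K hK k hk h1
    · exact (mem_sdiff.1 (h.sub K hK hk)).2 h1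
  odd := h.odd
  disj := h.disj
  closed K hK k hk v hv hadj := by
    by_cases hvT : v ∈ T
    · exact Or.inr (mem_union_right _ hvT)
    · exact (h.closed K hK k hk v (mem_sdiff.2 ⟨hv, hvT⟩) hadj).imp id (mem_union_left _)

lemma Barrier.erase {C S : Finset V} {𝒦 : Finset (Finset V)} (h : Barrier G C S 𝒦) {c : V}
    (hc : ∀ K ∈ 𝒦, c ∉ K) : Barrier G (C.erase c) (S.erase c) 𝒦 := by
  have := h.ambient (erase_subset c C) (fun K hK k hk => mem_erase.2
    ⟨by rintro rfl; exact hc K hK hk, h.sub K hK hk⟩)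
  convert this using 1
  ext v
  simp only [mem_erase, mem_inter]
  exact ⟨fun hv => ⟨hv.2, hv.1, h.subset hv.2⟩, fun hv => ⟨hv.2.1, hv.1⟩⟩

lemma FactorCritical.card_le {C S : Finset V} {𝒦 : Finset (Finset V)} (hC : FactorCritical G C)
    (h : Barrier G C S 𝒦) {c : V} (hcC : c ∈ C) (hc : ∀ K ∈ 𝒦, c ∉ K) :
    𝒦.card ≤ (S.erase c).card :=
  (h.erase hc).card_le (hC.2 c hcC)

/-- After deleting a vertex of `S` the rest of `C` is matchable, and its members need distinct
partners in what is left of `S`. -/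
lemma FactorCritical.card_lt {C S : Finset V} {𝒦 : Finset (Finset V)} (hC : FactorCritical G C)
    (h : Barrier G C S 𝒦) (hS : S.Nonempty) : 𝒦.card + 1 ≤ S.card := by
  obtain ⟨s, hs⟩ := hS
  have := hC.card_le h (h.subset hs) (fun K hK hsK => h.notMem K hK s hsK hs)
  rw [card_erase_of_mem hs] at this
  have := card_pos.2 ⟨s, hs⟩
  omega

/-- Deleting a vertex of `S` makes the barrier tight, so the remainder is matched within itself. -/
lemma FactorCritical.matchable_rest {C S : Finset V} {𝒦 : Finset (Finset V)}
    (hC : FactorCritical G C) (h : Barrier G C S 𝒦) (hS : S.Nonempty)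
    (hcard : S.card ≤ 𝒦.card + 1) : Matchable G (Barrier.rest C S 𝒦) := by
  obtain ⟨s, hs⟩ := hS
  have hsK : ∀ K ∈ 𝒦, s ∉ K := fun K hK hsK => h.notMem K hK s hsK hs
  have := ((h.erase hsK).tight (hC.2 s (h.subset hs)) (by
    rw [card_erase_of_mem hs]; omega)).2
  convert this using 1
  ext v
  simp only [Barrier.rest, mem_sdiff, mem_union, mem_erase, mem_biUnion, id]
  by_cases hvs : v = s
  · subst hvs; simp [hs]
  · simp [hvs]

lemma nbr_sdiff {S T : Finset V} {𝒦 : Finset (Finset V)} :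
    nbr G (S \ T) 𝒦 = nbr G S 𝒦 \ T := by
  ext v; simp only [mem_nbr, mem_sdiff]; tauto

lemma nbr_nbr {S : Finset V} {𝒦 𝒦' : Finset (Finset V)} (h : 𝒦' ⊆ 𝒦) :
    nbr G (nbr G S 𝒦) 𝒦' = nbr G S 𝒦' := by
  ext v
  constructor
  · intro hv
    obtain ⟨h1, h2⟩ := mem_nbr.1 hv
    exact mem_nbr.2 ⟨nbr_subset h1, h2⟩
  · intro hv
    exact mem_nbr.2 ⟨nbr_mono h hv, (mem_nbr.1 hv).2⟩

lemma card_sdiff_pair_ge {A : Finset V} {x x' : V} : A.card ≤ (A \ {x, x'}).card + 2 := by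
  have h1 := le_card_sdiff ({x, x'} : Finset V) A
  have h2 := card_le_two (a := x) (b := x')
  omega

/-- A pair `u v` and a vertex `w` whose deletion leaves an unmatchable set yield an end with two
attachments, or two ends with at least three attachments each. -/
theorem exists_isEnd {C : Finset V} (hC : FactorCritical G C) {u v w : V} (hu : u ∈ C)
    (hv : v ∈ C) (hw : w ∈ C) (huv : G.Adj u v) (huw : u ≠ w) (hvw : v ≠ w)
    (hflat : ¬ Matchable G (C \ {u, v, w})) :
    (∃ K a b, IsEnd G C K {a, b} ∧ a ≠ b ∧ (∃ k ∈ K, G.Adj a k) ∧ (∃ k ∈ K, G.Adj b k) ∧ w ∉ K ∧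
      ((C \ K) \ {a, b}).Nonempty) ∨
    (∃ K₁ K₂ X, IsEnd G C K₁ X ∧ IsEnd G C K₂ X ∧ Disjoint K₁ K₂ ∧ 3 ≤ (nbr G X {K₁}).card ∧
      3 ≤ (nbr G X {K₂}).card ∧ w ∉ K₁ ∧ w ∉ K₂ ∧ ∃ g ∈ X, ∀ x ∈ X, x ≠ g →
        Matchable G ((C \ K₁) \ {w, x}) ∧ Matchable G ((C \ K₂) \ {w, x})) := by
  classical
  have huv' := huv.ne
  have hsub : ({u, v, w} : Finset V) ⊆ C := by
    intro z hz; simp only [mem_insert, mem_singleton] at hz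
    rcases hz with rfl | rfl | rfl <;> assumption
  have hc3 : ({u, v, w} : Finset V).card = 3 := card_eq_three.2 ⟨u, v, w, huv', huw, hvw, rfl⟩
  have hsd := card_sdiff_add_card_eq_card hsub
  have hodd := hC.odd_card
  obtain ⟨S₀, 𝒦₀, hB₀, hc₀⟩ := exists_barrier_of_not_matchable _ (by
    obtain ⟨a, ha⟩ := hodd
    exact ⟨a - 1, by omega⟩) hflat
  -- Tutte gives at least `|S₀| + 2` members; putting `u`, `v`, `w` into `S₀` leaves `|S| ≤ |𝒦| +
  -- 1`. Only `u` and `v` are kept in `S`; `w` merely avoids the members.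
  let P : Finset V × Finset (Finset V) → Prop := fun p =>
    Barrier G C p.1 p.2 ∧ u ∈ p.1 ∧ v ∈ p.1 ∧ (∀ K ∈ p.2, w ∉ K) ∧ p.1.card ≤ p.2.card + 1
  let supp : Finset V × Finset (Finset V) → ℕ := fun p => (p.1 ∪ p.2.biUnion id).card
  -- Least support comes first and gives the matchability of `C \ K`; largest `S` comes second and
  -- gives factor-critical members.
  obtain ⟨p₁, hp₁, hmin₁⟩ := exists_minimal_measure (P := P) supp ⟨(S₀ ∪ {u, v, w}, 𝒦₀),
    hB₀.lift hsub, by simp, by simp, fun K hK hwK => by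
      have := hB₀.sub K hK hwK; simp at this, by
      have := card_union_le S₀ {u, v, w}; simp only; omega⟩
  obtain ⟨⟨S, 𝒦⟩, ⟨⟨hB, huS, hvS, hwK, hcard⟩, hsupp⟩, hmax⟩ := exists_maximal_of_bounded
    (P := fun p => P p ∧ supp p ≤ supp p₁)
    (fun p => p.1.card) C.card (fun p hp => card_le_card hp.1.1.subset) ⟨p₁, hp₁, le_rfl⟩
  simp only at hB huS hvS hwK hcard
  have hmin : ∀ S' 𝒦', Barrier G C S' 𝒦' → u ∈ S' → v ∈ S' → (∀ K ∈ 𝒦', w ∉ K) →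
      S'.card ≤ 𝒦'.card + 1 → supp (S, 𝒦) ≤ supp (S', 𝒦') := fun S' 𝒦' h1 h2 h3 h4 h5 =>
    hsupp.trans (hmin₁ (S', 𝒦') ⟨h1, h2, h3, h4, h5⟩)
  have hcard' : S.card = 𝒦.card + 1 := le_antisymm hcard (hC.card_lt hB ⟨u, huS⟩)
  have hS2 : 2 ≤ S.card := by
    have := card_le_card (show ({u, v} : Finset V) ⊆ S by
      intro z hz; simp only [mem_insert, mem_singleton] at hz; rcases hz with rfl | rfl <;> assumption)
    rwa [card_pair huv'] at this
  -- members are factor-critical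
  have hFC : ∀ K ∈ 𝒦, FactorCritical G K := by
    intro K hK
    refine ⟨hB.nonempty hK, fun k hk => ?_⟩
    by_contra hnm
    obtain ⟨S', 𝒦', h', hc⟩ := exists_barrier_of_not_matchable _ (by
      obtain ⟨a, ha⟩ := hB.odd K hK
      rw [card_erase_of_mem hk]; exact ⟨a, by omega⟩) hnm
    have h1 := hB.refine hK hk h'
    have h2 := hB.card_refine_left hK hk h'
    have h3 := hB.card_refine_right hK h'
    have h4 := hmax (insert k (S ∪ S'), 𝒦.erase K ∪ 𝒦') ⟨⟨h1, by simp [huS], by simp [hvS], by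
      intro L hL hwL
      rcases mem_union.1 hL with hL | hL
      · exact hwK L (mem_erase.1 hL).2 hwL
      · exact hwK K hK (mem_erase.1 (h'.sub L hL hwL)).2, by simp only; omega⟩, by
      refine le_trans (card_le_card ?_) hsupp
      intro z hz
      simp only [mem_union, mem_insert, mem_biUnion, id, mem_erase] at hz ⊢
      rcases hz with (rfl | h | h) | ⟨L, ⟨-, hL⟩ | hL, hz⟩
      · exact Or.inr ⟨K, hK, hk⟩
      · exact Or.inl h
      · exact Or.inr ⟨K, hK, (mem_erase.1 (h'.subset h)).2⟩
      · exact Or.inr ⟨L, hL, hz⟩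
      · exact Or.inr ⟨K, hK, (mem_erase.1 (h'.sub L hL hz)).2⟩⟩
    simp only at h4
    omega
  have hNlow : ∀ Z ⊆ 𝒦, Z.Nonempty → Z.card + 1 ≤ (nbr G S Z).card := by
    intro Z hZ hne
    have hBZ := hB.restrict hZ
    refine hC.card_lt hBZ ?_
    have := hC.card_le hBZ hu (fun K hK huK => hB.notMem K (hZ hK) u huK huS)
    have hpos := card_pos.2 hne
    obtain ⟨x, hx⟩ := card_pos.1 (hpos.trans_le this)
    exact ⟨x, (mem_erase.1 hx).2⟩
  -- In a smallest subfamily with only one extra neighbour, every proper nonempty subfamily has two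
  -- extra neighbours. This slack keeps Hall's condition after two vertices of `nbr G S Z` are
  -- deleted.
  obtain ⟨Z, ⟨hZ, hZne, hZc⟩, hZmin⟩ := exists_minimal_measure
    (P := fun Z => Z ⊆ 𝒦 ∧ Z.Nonempty ∧ (nbr G S Z).card ≤ Z.card + 1) card
    ⟨𝒦, subset_rfl, card_pos.1 (by omega), (card_le_card nbr_subset).trans hcard⟩
  have hNprop : ∀ Z' ⊆ Z, Z'.Nonempty → Z'.card < Z.card → Z'.card + 2 ≤ (nbr G S Z').card := by
    intro Z' h1 h2 h3
    by_contra h4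
    have := hZmin Z' ⟨h1.trans hZ, h2, by omega⟩
    omega
  have hXc : (nbr G S Z).card = Z.card + 1 := le_antisymm hZc (hNlow Z hZ hZne)
  have hBZ := hB.restrict hZ
  have hXne : (nbr G S Z).Nonempty := card_pos.1 (by omega)
  have hWm := hC.matchable_rest hBZ hXne hXc.le
  -- the part of the barrier on `Z`, without a member and two vertices
  have hpart : ∀ K ∈ Z, ∀ x ∈ nbr G S Z, ∀ x' ∈ nbr G S Z, x ≠ x' →
      Matchable G ((nbr G S Z \ {x, x'}) ∪ (Z.erase K).biUnion id) := by
    intro K hK x hx x' hx' hne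
    have hpair : ({x, x'} : Finset V) ⊆ nbr G S Z := by
      intro z hz; simp only [mem_insert, mem_singleton] at hz; rcases hz with rfl | rfl <;> assumption
    have h1 := card_sdiff_add_card_eq_card hpair
    rw [card_pair hne] at h1
    refine matchable_of_hall (fun L hL => hFC L (hZ (mem_erase.1 hL).2))
      (hBZ.pairwiseDisjoint.subset (by simp)) ?_ ?_ ?_
    · intro L hL l hl hmem
      exact hBZ.notMem L (mem_erase.1 hL).2 l hl (mem_sdiff.1 hmem).1
    · rw [card_erase_of_mem hK]; omega
    · intro Z' hZ'
      have hZ'Z := hZ'.trans (erase_subset _ _)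
      obtain rfl | hne' := Z'.eq_empty_or_nonempty
      · simp
      have h2 := hNprop Z' hZ'Z hne' ((card_le_card hZ').trans_lt (card_erase_lt_of_mem hK))
      rw [nbr_sdiff, nbr_nbr hZ'Z]
      have := card_sdiff_pair_ge (A := nbr G S Z') (x := x) (x' := x')
      omega
  -- Match `u` with `v`, and the other members with `S \ {u, v}` by Hall. A violating family would
  -- have both `u` and `v` as neighbours and would form, with its neighbours, a barrier of smaller
  -- support.
  have hmatch : ∀ K ∈ Z, Matchable G (C \ K) := by
    intro K hK
    have hK𝒦 := hZ hK
    have hpair : ({u, v} : Finset V) ⊆ S := by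
      intro z hz; simp only [mem_insert, mem_singleton] at hz; rcases hz with rfl | rfl <;> assumption
    have h1 := card_sdiff_add_card_eq_card hpair
    rw [card_pair huv'] at h1
    have h2 : Matchable G ((S \ {u, v}) ∪ (𝒦.erase K).biUnion id) := by
      refine matchable_of_hall (fun L hL => hFC L (mem_erase.1 hL).2)
        (hB.pairwiseDisjoint.subset (by simp)) ?_ ?_ ?_
      · intro L hL l hl hmem
        exact hB.notMem L (mem_erase.1 hL).2 l hl (mem_sdiff.1 hmem).1
      · rw [card_erase_of_mem hK𝒦]; omega
      · intro 𝒦' h𝒦'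
        have hsub' := h𝒦'.trans (erase_subset _ _)
        obtain rfl | hne' := 𝒦'.eq_empty_or_nonempty
        · simp
        have h3 := hNlow 𝒦' hsub' hne'
        by_contra hlt
        rw [nbr_sdiff] at hlt
        have h4 := card_sdiff_pair_ge (A := nbr G S 𝒦') (x := u) (x' := v)
        have hmem : u ∈ nbr G S 𝒦' ∧ v ∈ nbr G S 𝒦' := by
          by_contra hnot
          have : (nbr G S 𝒦').card ≤ (nbr G S 𝒦' \ {u, v}).card + 1 := by
            by_cases huN : u ∈ nbr G S 𝒦'
            · have hvN : v ∉ nbr G S 𝒦' := fun h => hnot ⟨huN, h⟩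
              have : (nbr G S 𝒦').erase u ⊆ nbr G S 𝒦' \ {u, v} := by
                intro z hz
                obtain ⟨h5, h6⟩ := mem_erase.1 hz
                simp only [mem_sdiff, mem_insert, mem_singleton]
                exact ⟨h6, by rintro (rfl | rfl); exacts [h5 rfl, hvN h6]⟩
              have := card_le_card this
              rw [card_erase_of_mem huN] at this
              omega
            · have : (nbr G S 𝒦').erase v ⊆ nbr G S 𝒦' \ {u, v} := by
                intro z hz
                obtain ⟨h5, h6⟩ := mem_erase.1 hz
                simp only [mem_sdiff, mem_insert, mem_singleton]
                exact ⟨h6, by rintro (rfl | rfl); exacts [huN h6, h5 rfl]⟩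
              have := card_le_card this
              have := pred_card_le_card_erase (s := nbr G S 𝒦') (a := v)
              omega
          omega
        have h5 := hmin _ _ (hB.restrict hsub') hmem.1 hmem.2
          (fun L hL => hwK L (hsub' hL)) (by omega)
        have h6 : supp (nbr G S 𝒦', 𝒦') < supp (S, 𝒦) := by
          refine card_lt_card ?_
          refine ⟨union_subset_union nbr_subset (biUnion_subset_biUnion_of_subset_left _ hsub'), ?_⟩
          intro hsub''
          obtain ⟨k, hk⟩ := hB.nonempty hK𝒦
          have := hsub'' (mem_union_right _ (mem_biUnion.2 ⟨K, hK𝒦, hk⟩))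
          rcases mem_union.1 this with h7 | h7
          · exact hB.notMem K hK𝒦 k hk (nbr_subset h7)
          · obtain ⟨L, hL, hkL⟩ := mem_biUnion.1 h7
            exact (mem_erase.1 (h𝒦' hL)).1 (hB.disj L (hsub' hL) K hK𝒦 k hkL hk)
        omega
    have h3 := hC.matchable_rest hB ⟨u, huS⟩ hcard
    have h4 := ((matchable_pair huv).union h2 ?_).union h3 ?_
    · convert h4 using 1
      ext z
      simp only [mem_sdiff, mem_union, mem_insert, mem_singleton, mem_biUnion, mem_erase, id,
        Barrier.mem_rest]
      constructor
      · rintro ⟨hzC, hzK⟩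
        by_cases hzS : z ∈ S
        · tauto
        by_cases hz : ∃ L ∈ 𝒦, z ∈ L
        · obtain ⟨L, hL, hzL⟩ := hz
          exact Or.inl (Or.inr (Or.inr ⟨L, ⟨by rintro rfl; exact hzK hzL, hL⟩, hzL⟩))
        · push Not at hz
          exact Or.inr ⟨hzC, hzS, hz⟩
      · have hSK : ∀ s ∈ S, s ∉ K := fun s hs hsK => hB.notMem K hK𝒦 s hsK hs
        rintro (((rfl | rfl) | (h | ⟨L, ⟨hne, hL⟩, hz⟩)) | h)
        · exact ⟨hu, hSK _ huS⟩
        · exact ⟨hv, hSK _ hvS⟩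
        · exact ⟨hB.subset h.1, hSK _ h.1⟩
        · exact ⟨hB.sub L hL hz, fun hzK => hne (hB.disj L hL K hK𝒦 z hz hzK)⟩
        · exact ⟨h.1, h.2.2 K hK𝒦⟩
    · rw [disjoint_left]
      intro z hz hz'
      rcases mem_union.1 hz' with h | h
      · exact (mem_sdiff.1 h).2 hz
      · obtain ⟨L, hL, hzL⟩ := mem_biUnion.1 h
        exact hB.notMem L (mem_erase.1 hL).2 z hzL (hpair hz)
    · rw [disjoint_left]
      intro z hz hz'
      rw [Barrier.mem_rest] at hz'
      simp only [mem_sdiff, mem_union, mem_biUnion, mem_erase, id] at hz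
      rcases hz with h | h | ⟨L, hL, hzL⟩
      · exact hz'.2.1 (hpair h)
      · exact hz'.2.1 h.1
      · exact hz'.2.2 L hL.2 hzL
  have hunion : ∀ K ∈ Z, ∀ x ∈ nbr G S Z, ∀ x' ∈ nbr G S Z, x ≠ x' → ∀ R, Matchable G R →
      (∀ r ∈ R, r = x' ∨ r ∈ Barrier.rest C (nbr G S Z) Z) →
      Matchable G (((nbr G S Z \ {x, x'}) ∪ (Z.erase K).biUnion id) ∪ R) := by
    intro K hK x hx x' hx' hne R hR hsub'
    refine (hpart K hK x hx x' hx' hne).union hR ?_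
    rw [disjoint_left]
    intro z hz hz'
    simp only [mem_union, mem_sdiff, mem_insert, mem_singleton, mem_biUnion, mem_erase, id] at hz
    rcases hsub' z hz' with rfl | h
    · rcases hz with h1 | ⟨L, hL, hzL⟩
      · exact h1.2 (Or.inr rfl)
      · exact hBZ.notMem L hL.2 _ hzL hx'
    · rw [Barrier.mem_rest] at h
      rcases hz with h1 | ⟨L, hL, hzL⟩
      · exact h.2.1 h1.1
      · exact h.2.2 L hL.2 hzL
  have hcover : ∀ K ∈ Z, ∀ z ∈ C, z ∉ K → z ∈ nbr G S Z ∨ (∃ L, (L ≠ K ∧ L ∈ Z) ∧ z ∈ L) ∨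
      z ∈ Barrier.rest C (nbr G S Z) Z := by
    intro K hK z hz hzK
    by_cases h1 : z ∈ nbr G S Z
    · exact Or.inl h1
    by_cases h2 : ∃ L ∈ Z, z ∈ L
    · obtain ⟨L, hL, hzL⟩ := h2
      exact Or.inr (Or.inl ⟨L, ⟨by rintro rfl; exact hzK hzL, hL⟩, hzL⟩)
    · push Not at h2
      exact Or.inr (Or.inr (Barrier.mem_rest.2 ⟨hz, h1, h2⟩))
  have hXK : ∀ K ∈ Z, ∀ x ∈ nbr G S Z, x ∉ K := fun K hK x hx hxK => hBZ.notMem K hK x hxK hx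
  have hLK : ∀ K ∈ Z, ∀ L, L ≠ K → L ∈ Z → ∀ z ∈ L, z ∈ C ∧ z ∉ K ∧ z ∉ nbr G S Z ∧
      z ∉ Barrier.rest C (nbr G S Z) Z := by
    intro K hK L hne hL z hz
    exact ⟨hBZ.sub L hL hz, fun hzK => hne (hBZ.disj L hL K hK z hz hzK), hBZ.notMem L hL z hz,
      fun h => (Barrier.mem_rest.1 h).2.2 L hL hz⟩
  have hend : ∀ K ∈ Z, IsEnd G C K (nbr G S Z) := by
    intro K hK
    refine ⟨hBZ.sub K hK, hBZ.subset, hXK K hK, hFC K (hZ hK), hBZ.closed K hK, hmatch K hK, ?_⟩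
    intro x hx x' hx' hne
    convert hunion K hK x hx x' hx' hne _ hWm (fun r hr => Or.inr hr) using 1
    ext z
    simp only [mem_sdiff, mem_union, mem_insert, mem_singleton, mem_biUnion, mem_erase, id]
    constructor
    · rintro ⟨⟨hzC, hzK⟩, hzx⟩
      rcases hcover K hK z hzC hzK with h | h | h
      · tauto
      · exact Or.inl (Or.inr h)
      · tauto
    · rintro ((h | ⟨L, ⟨hne', hL⟩, hz⟩) | h)
      · exact ⟨⟨hBZ.subset h.1, hXK K hK z h.1⟩, h.2⟩
      · obtain ⟨h1, h2, h3, h4⟩ := hLK K hK L hne' hL z hz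
        exact ⟨⟨h1, h2⟩, by rintro (rfl | rfl) <;> exact h3 (by assumption)⟩
      · obtain ⟨h1, h2, h3⟩ := Barrier.mem_rest.1 h
        exact ⟨⟨h1, h3 K hK⟩, by rintro (rfl | rfl) <;> exact h2 (by assumption)⟩
  -- With several members, each one alone is a proper subfamily and so has at least three
  -- neighbours. With one member there are exactly two attachments.
  rcases Nat.lt_or_ge 1 Z.card with hZ2 | hZ1
  · right
    obtain ⟨K₁, hK₁, K₂, hK₂, hne⟩ := one_lt_card.1 hZ2
    have h3 : ∀ K ∈ Z, 3 ≤ (nbr G (nbr G S Z) {K}).card := by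
      intro K hK
      have hs : ({K} : Finset (Finset V)) ⊆ Z := singleton_subset_iff.2 hK
      rw [nbr_nbr hs]
      have := hNprop {K} hs (singleton_nonempty _) (by simpa using hZ2)
      simpa using this
    refine ⟨K₁, K₂, nbr G S Z, hend K₁ hK₁, hend K₂ hK₂, hBZ.pairwiseDisjoint hK₁ hK₂ hne,
      h3 K₁ hK₁, h3 K₂ hK₂, hwK K₁ (hZ hK₁), hwK K₂ (hZ hK₂), ?_⟩
    suffices h : ∃ g ∈ nbr G S Z, ∀ x ∈ nbr G S Z, x ≠ g → ∀ K ∈ Z,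
        Matchable G ((C \ K) \ {w, x}) by
      obtain ⟨g, hg, h⟩ := h
      exact ⟨g, hg, fun x hx hxg => ⟨h x hx hxg K₁ hK₁, h x hx hxg K₂ hK₂⟩⟩
    by_cases hwX : w ∈ nbr G S Z
    · exact ⟨w, hwX, fun x hx hxw K hK => (hend K hK).matchable_pair w hwX x hx hxw.symm⟩
    have hwR : w ∈ Barrier.rest C (nbr G S Z) Z :=
      Barrier.mem_rest.2 ⟨hw, hwX, fun K hK => hwK K (hZ hK)⟩
    have hBw := hBZ.erase (c := w) (fun K hK => hwK K (hZ hK))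
    rw [erase_eq_of_notMem hwX] at hBw
    have hrw : Barrier.rest (C.erase w) (nbr G S Z) Z =
        (Barrier.rest C (nbr G S Z) Z).erase w := by
      ext z; simp only [Barrier.mem_rest, mem_erase]; tauto
    have hodd' : Odd (Barrier.rest (C.erase w) (nbr G S Z) Z).card := by
      rw [hrw, card_erase_of_mem hwR]
      have := card_pos.2 ⟨w, hwR⟩
      obtain ⟨a, ha⟩ := hWm.even_card
      exact ⟨a - 1, by omega⟩
    -- Deleting `w` makes the remainder odd. As a further member it makes the barrier of `C.erase w`
    -- tight, and `g` is the attachment through which it is matched.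
    obtain ⟨g, hg, hgm⟩ := ((hBw.add_rest hodd').tight (hC.2 w hw) (by
      rw [Barrier.card_add_rest hodd', hXc])).1 _ (mem_insert_self _ _)
    rw [hrw] at hgm
    refine ⟨g, hg, fun x hx hxg K hK => ?_⟩
    convert hunion K hK x hx g hg hxg _ hgm (fun r hr => by
      rcases mem_insert.1 hr with rfl | h
      · exact Or.inl rfl
      · exact Or.inr (mem_erase.1 h).2) using 1
    ext z
    simp only [mem_sdiff, mem_union, mem_insert, mem_singleton, mem_biUnion, mem_erase, id]
    constructor
    · rintro ⟨⟨hzC, hzK⟩, hzx⟩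
      rcases hcover K hK z hzC hzK with h | h | h
      · tauto
      · exact Or.inl (Or.inr h)
      · tauto
    · rintro ((h | ⟨L, ⟨hne', hL⟩, hz⟩) | (rfl | h))
      · exact ⟨⟨hBZ.subset h.1, hXK K hK z h.1⟩, by
          rintro (rfl | rfl)
          · exact hwX h.1
          · exact h.2 (Or.inl rfl)⟩
      · obtain ⟨h1, h2, h3, h4⟩ := hLK K hK L hne' hL z hz
        exact ⟨⟨h1, h2⟩, by
          rintro (rfl | rfl)
          · exact h4 hwR
          · exact h3 hx⟩
      · exact ⟨⟨hBZ.subset hg, hXK K hK z hg⟩, by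
          rintro (rfl | rfl)
          · exact hwX hg
          · exact hxg rfl⟩
      · obtain ⟨h1, h2, h3⟩ := Barrier.mem_rest.1 h.2
        exact ⟨⟨h1, h3 K hK⟩, by
          rintro (rfl | rfl)
          · exact h.1 rfl
          · exact h2 hx⟩
  · left
    have hZ1' : Z.card = 1 := le_antisymm hZ1 (card_pos.2 hZne)
    obtain ⟨K, rfl⟩ := card_eq_one.1 hZ1'
    have hK : K ∈ ({K} : Finset (Finset V)) := mem_singleton_self K
    rw [card_singleton] at hXc
    obtain ⟨a, b, hab, hX⟩ := card_eq_two.1 hXc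
    have hadj : ∀ x ∈ nbr G S {K}, ∃ k ∈ K, G.Adj x k := by
      intro x hx
      obtain ⟨-, L, hL, h⟩ := mem_nbr.1 hx
      rwa [mem_singleton.1 hL] at h
    have he := hend K hK
    refine ⟨K, a, b, hX ▸ he, hab, hadj a (by simp [hX]), hadj b (by simp [hX]),
      hwK K (hZ hK), ?_⟩
    -- If nothing were left, `u`, `v`, `w` would be three vertices of the two-element attachment
    -- set.
    by_contra hemp
    rw [not_nonempty_iff_eq_empty, sdiff_eq_empty_iff_subset, ← hX] at hemp
    have hall : ∀ z ∈ C, z ∉ K → z ∈ nbr G S {K} := fun z hz hzK => hemp (mem_sdiff.2 ⟨hz, hzK⟩)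
    have hsub3 : ({u, v, w} : Finset V) ⊆ nbr G S {K} := by
      intro z hz
      simp only [mem_insert, mem_singleton] at hz
      rcases hz with rfl | rfl | rfl
      · exact hall _ hu fun h => hB.notMem K (hZ hK) _ h huS
      · exact hall _ hv fun h => hB.notMem K (hZ hK) _ h hvS
      · exact hall _ hw (hwK K (hZ hK))
    have := card_le_card hsub3
    omega

lemma Matchable.of_parts {A B U : Finset V} (hA : Matchable G A) (hB : Matchable G B)
    (hU : ∀ v, v ∈ U ↔ v ∈ A ∨ v ∈ B) (hd : ∀ v ∈ A, v ∉ B) : Matchable G U := by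
  have := hA.union hB (disjoint_left.2 hd)
  convert this using 1
  ext v; rw [hU, mem_union]

lemma Matchable.congr {A U : Finset V} (hA : Matchable G A) (hU : ∀ v, v ∈ U ↔ v ∈ A) :
    Matchable G U := by
  rwa [show U = A from ext hU]

namespace IsEnd

variable {C K X : Finset V}

/-- Completing a matching inside `K`. -/
lemma matchable_sdiff (h : IsEnd G C K X) {T : Finset V} (hT : T ⊆ K) (hm : Matchable G (K \ T)) :
    Matchable G (C \ T) := by
  refine hm.of_parts h.matchable ?_ ?_
  · have := h.sub
    grind
  · grind

lemma matchable_sdiff_pair (h : IsEnd G C K X) {k x x' : V} (hk : k ∈ K) (hx : x ∈ X)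
    (hx' : x' ∈ X) (hne : x ≠ x') : Matchable G (C \ {k, x, x'}) := by
  refine (h.fc.2 k hk).of_parts (h.matchable_pair x hx x' hx' hne) ?_ ?_
  · have := h.sub
    have := h.notMem
    grind
  · grind

/-- Completing a matching of `K` with one edge leaving `K`. -/
lemma matchable_of_cross (h : IsEnd G C K X) {T : Finset V} {k x : V} (hk : k ∈ K)
    (hx : x ∈ X) (hadj : G.Adj x k) (hm : Matchable G (K \ insert k T)) (hkT : k ∉ T)
    (hxT : x ∉ T) (hA : Matchable G ((C \ K) \ insert x T)) : Matchable G (C \ T) := by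
  have h1 := h.notMem x hx
  have h2 := h.subset hx
  have h3 := h.sub
  refine ((ExtendedMatching.matchable_pair hadj).of_parts hm (U := insert x (K \ T)) ?_ ?_).of_parts
    hA ?_ ?_ <;> grind

/-- Completing a matching of `K` with two edges leaving `K`. -/
lemma matchable_of_cross_two (h : IsEnd G C K X) {T : Finset V} {k x k' x' : V} (hT : T ⊆ K)
    (hk : k ∈ K) (hk' : k' ∈ K) (hx : x ∈ X) (hx' : x' ∈ X) (hadj : G.Adj x k)
    (hadj' : G.Adj x' k') (hkk' : k ≠ k') (hxx' : x ≠ x') (hkT : k ∉ T) (hkT' : k' ∉ T)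
    (hm : Matchable G (K \ insert k (insert k' T))) : Matchable G (C \ T) := by
  have h1 := h.notMem
  have h2 := h.subset
  have h3 := h.sub
  have hA := h.matchable_pair x hx x' hx' hxx'
  refine (((ExtendedMatching.matchable_pair hadj).of_parts
    (ExtendedMatching.matchable_pair hadj') (U := {x, k, x', k'}) ?_ ?_).of_parts hm
    (U := insert x (insert x' (K \ T))) ?_ ?_).of_parts hA ?_ ?_ <;> grind

/-- Otherwise a matching of `K \ {k, p, q}`, the edge `x k` and a matching of `C \ K` without `x`
and `r` would together match `C \ {p, q, r}`. -/
lemma not_matchable_of_cross (h : IsEnd G C K X) {p q r : V} (hp : p ∈ K) (hq : q ∈ K)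
    (hr : r ∈ X) (hflat : ¬ Matchable G (C \ {p, q, r})) :
    ∀ k ∈ K, k ≠ p → k ≠ q → ∀ x ∈ X, x ≠ r → G.Adj x k → ¬ Matchable G (K \ {k, p, q}) := by
  intro k hk hkp hkq x hxX hxr hadj hm
  have := h.notMem r hr
  have := h.notMem x hxX
  exact hflat (h.matchable_of_cross hk hxX hadj (hm.congr (by grind)) (by grind) (by grind)
    ((h.matchable_pair x hxX r hr hxr).congr (by grind)))

end IsEnd

/-! ### Bounds on flat triangles and pairs, and rooted weights. -/

/-- A triangle whose deletion from `C` leaves an unmatchable set has nonpositive weight. -/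
def TriangleBound (G : SimpleGraph V) (C : Finset V) (y : V → ℤ) (p q r : V) : Prop :=
  G.Adj p q → G.Adj q r → G.Adj p r → ¬ Matchable G (C \ {p, q, r}) → y p + y q + y r ≤ 0

lemma triangleBound_of_sorted {C D : Finset V} {y : V → ℤ} (c : V → ℕ)
    (h : ∀ p ∈ D, ∀ q ∈ D, ∀ r ∈ D, c p ≤ c q → c q ≤ c r → TriangleBound G C y p q r) :
    ∀ p ∈ D, ∀ q ∈ D, ∀ r ∈ D, TriangleBound G C y p q r := by
  have swap₁ : ∀ p q r, TriangleBound G C y p q r → TriangleBound G C y q p r := by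
    intro p q r H h1 h2 h3 h4
    have := H h1.symm h3 h2 (by rwa [insert_comm])
    linarith
  have swap₂ : ∀ p q r, TriangleBound G C y p q r → TriangleBound G C y p r q := by
    intro p q r H h1 h2 h3 h4
    have := H h3 h2.symm h1 (by rwa [pair_comm])
    linarith
  intro p hp q hq r hr
  rcases le_total (c p) (c q) with h1 | h1 <;> rcases le_total (c q) (c r) with h2 | h2 <;>
    rcases le_total (c p) (c r) with h3 | h3
  · exact h p hp q hq r hr h1 h2
  · exact h p hp q hq r hr h1 h2
  · exact swap₂ _ _ _ (h p hp r hr q hq h3 h2)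
  · exact swap₂ _ _ _ (swap₁ _ _ _ (h r hr p hp q hq h3 h1))
  · exact swap₁ _ _ _ (h q hq p hp r hr h1 h3)
  · exact swap₁ _ _ _ (swap₂ _ _ _ (h q hq r hr p hp h2 h3))
  · exact swap₁ _ _ _ (swap₂ _ _ _ (swap₁ _ _ _ (h r hr q hq p hp h2 h1)))
  · exact swap₁ _ _ _ (swap₂ _ _ _ (swap₁ _ _ _ (h r hr q hq p hp h2 h1)))

/-- A pair whose deletion together with `j` from `C` leaves an unmatchable set has nonpositive
weight. -/
def PairBound (G : SimpleGraph V) (C : Finset V) (j : V) (y : V → ℤ) (p q : V) : Prop :=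
  G.Adj p q → ¬ Matchable G (C \ {j, p, q}) → y p + y q ≤ 0

lemma pairBound_of_sorted {C D : Finset V} {j : V} {y : V → ℤ} (c : V → ℕ)
    (h : ∀ p ∈ D, ∀ q ∈ D, c p ≤ c q → PairBound G C j y p q) :
    ∀ p ∈ D, ∀ q ∈ D, PairBound G C j y p q := by
  intro p hp q hq
  rcases le_total (c p) (c q) with h1 | h1
  · exact h p hp q hq h1
  · intro h2 h3
    have := h q hq p hp h1 h2.symm (by rwa [pair_comm])
    linarith

/-- A weight on a factor-critical set `U` rooted at `j`. -/
structure RootedWeight (G : SimpleGraph V) (U : Finset V) (j : V) (y : V → ℤ) : Prop where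
  lower : ∀ v ∈ U, -1 ≤ y v
  upper : ∀ v ∈ U, y v ≤ 1
  root : y j ≤ 0
  total : 1 ≤ ∑ v ∈ U, y v
  edge : ∀ k ∈ U, G.Adj j k → y j + y k ≤ 0
  pair : ∀ p ∈ U.erase j, ∀ q ∈ U.erase j, PairBound G U j y p q
  triangle : ∀ p ∈ U.erase j, ∀ q ∈ U.erase j, ∀ r ∈ U.erase j, TriangleBound G U y p q r

/-- Rooted weights exist on all factor-critical sets with at least three and fewer than `n`
vertices. -/
def HasRootedWeights (V : Type*) [DecidableEq V] (n : ℕ) : Prop :=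
  ∀ (G : SimpleGraph V) (U : Finset V) (j : V), U.card < n → FactorCritical G U → 3 ≤ U.card →
    j ∈ U → ∃ y, RootedWeight G U j y

/-! ### The extension of an end and the weights it gives. -/

/-- The graph in which the vertex `a` is replaced by one adjacent to `b` and to all neighbours
of vertices in `X` other than `b`. -/
def extension (G : SimpleGraph V) (X : Finset V) (a b : V) : SimpleGraph V :=
  SimpleGraph.fromRel fun u v => (u ≠ a ∧ v ≠ a ∧ G.Adj u v) ∨
    (u = a ∧ (v = b ∨ ∃ x ∈ X, x ≠ b ∧ G.Adj x v))

lemma extension_adj {X : Finset V} {a b u v : V} (hu : u ≠ a) (hv : v ≠ a) :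
    (extension G X a b).Adj u v ↔ G.Adj u v := by
  simp only [extension, SimpleGraph.fromRel_adj]
  constructor
  · rintro ⟨-, h | h⟩
    · rcases h with h | h
      · exact h.2.2
      · exact absurd h.1 hu
    · rcases h with h | h
      · exact h.2.2.symm
      · exact absurd h.1 hv
  · intro h
    exact ⟨h.ne, Or.inl (Or.inl ⟨hu, hv, h⟩)⟩

lemma extension_adj_left {X : Finset V} {a b v : V} (hv : v ≠ a) :
    (extension G X a b).Adj a v ↔ v = b ∨ ∃ x ∈ X, x ≠ b ∧ G.Adj x v := by
  simp only [extension, SimpleGraph.fromRel_adj]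
  constructor
  · rintro ⟨-, h | h⟩
    · rcases h with h | h
      · exact absurd rfl h.1
      · exact h.2
    · rcases h with h | h
      · exact absurd rfl h.2.1
      · exact absurd h.1 hv
  · intro h
    exact ⟨hv.symm, Or.inl (Or.inr ⟨trivial, h⟩)⟩

lemma matchable_extension_iff {X U : Finset V} {a b : V} (ha : a ∉ U) :
    Matchable (extension G X a b) U ↔ Matchable G U := by
  have key : ∀ u ∈ U, ∀ v ∈ U, (extension G X a b).Adj u v ↔ G.Adj u v := fun u hu v hv =>
    extension_adj (by rintro rfl; exact ha hu) (by rintro rfl; exact ha hv)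
  exact ⟨fun h => h.mono fun u hu v hv => (key u hu v hv).1,
    fun h => h.mono fun u hu v hv => (key u hu v hv).2⟩

/-- A weight on an end `K` with values `A`, `B` for its outer vertices: `B` for `b` and `A` for
the others. -/
structure EndValues (G : SimpleGraph V) (C K X : Finset V) (b : V) (y : V → ℤ) (A B : ℤ) :
    Prop where
  lower : ∀ k ∈ K, -1 ≤ y k
  upper : ∀ k ∈ K, y k ≤ 1
  lower_left : -1 ≤ A
  upper_left : A ≤ 0
  lower_right : -1 ≤ B
  upper_right : B ≤ 1
  add_le : A + B ≤ 0
  total : 1 ≤ ∑ k ∈ K, y k + A + B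
  edge : ∀ k ∈ K, ∀ x ∈ X, x ≠ b → G.Adj x k → y k + A ≤ 0
  triangle : ∀ p ∈ K, ∀ q ∈ K, ∀ r ∈ K, TriangleBound G C y p q r
  pair : ∀ p ∈ K, ∀ q ∈ K, G.Adj p q → (∀ k ∈ K, k ≠ p → k ≠ q → G.Adj b k →
    ¬ Matchable G (K \ {k, p, q})) → y p + y q ≤ 0
  pair_right : ∀ p ∈ K, ∀ q ∈ K, G.Adj p q → G.Adj b p → G.Adj b q →
    (∀ k ∈ K, k ≠ p → k ≠ q → ∀ x ∈ X, x ≠ b → G.Adj x k →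
    ¬ Matchable G (K \ {k, p, q})) → y p + y q + B ≤ 0

/-- After deleting `a` or `b`, the other one is matched into `K`; after deleting a vertex of `K`,
the pair `a b` is used. -/
lemma factorCritical_extension {K X : Finset V} (hK : FactorCritical G K) {a b : V} (hab : a ≠ b)
    (haK : a ∉ K) (hbK : b ∉ K) (hb : ∃ k ∈ K, G.Adj b k)
    (hx : ∃ x ∈ X, x ≠ b ∧ ∃ k ∈ K, G.Adj x k) :
    FactorCritical (extension G X a b) (insert a (insert b K)) := by
  refine ⟨⟨a, by simp⟩, ?_⟩
  intro v hv
  have hKe : FactorCritical (extension G X a b) K := ⟨hK.1, fun k hk =>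
    (matchable_extension_iff (by grind)).2 (hK.2 k hk)⟩
  simp only [mem_insert] at hv
  rcases hv with rfl | rfl | hv
  · obtain ⟨k, hk, hadj⟩ := hb
    refine ((matchable_extension_iff (by grind)).2 (hK.matchable_insert hbK hk hadj)).congr ?_
    grind
  · obtain ⟨x, hxX, hxb, k, hk, hadj⟩ := hx
    refine (hKe.matchable_insert haK hk ((extension_adj_left (by grind)).2
      (Or.inr ⟨x, hxX, hxb, hadj⟩))).congr ?_
    grind
  · refine (hKe.2 v hv).of_parts (matchable_pair ((extension_adj_left hab.symm).2 (Or.inl rfl)))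
      ?_ ?_ <;> grind

/-- Apply the induction hypothesis to `K` with `a` and `b` added, rooted at `a`, where `a` stands
for all attachments except `b`. A matching using `a b` leaves `K` closed, and `C \ K` is matched
separately. Any other matching has two edges leaving `K`, at `b` and at some `x ≠ b`, and is
completed outside by `matchable_pair`. -/
theorem IsEnd.exists_endValues {C K X : Finset V} (h : IsEnd G C K X)
    (hIH : HasRootedWeights V C.card) (hlt : K.card + 2 < C.card) {a b : V} (ha : a ∈ X)
    (hbX : b ∈ X) (hab : a ≠ b) (hb : ∃ k ∈ K, G.Adj b k)
    (hx : ∃ x ∈ X, x ≠ b ∧ ∃ k ∈ K, G.Adj x k) : ∃ y A B, EndValues G C K X b y A B := by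
  have haK := h.notMem a ha
  have hbK := h.notMem b hbX
  have haU : a ∉ insert b K := by grind
  have hcard : (insert a (insert b K)).card = K.card + 2 := by
    rw [card_insert_of_notMem haU, card_insert_of_notMem hbK]
  have hpos := card_pos.2 h.fc.1
  obtain ⟨y, hy⟩ := hIH (extension G X a b) (insert a (insert b K)) a (by omega)
    (factorCritical_extension h.fc hab haK hbK hb hx) (by omega) (by simp)
  have hKa : ∀ k ∈ K, k ≠ a := by rintro k hk rfl; exact haK hk
  have hmem : ∀ k ∈ K, k ∈ (insert a (insert b K)).erase a := by grind
  have hbmem : b ∈ (insert a (insert b K)).erase a := by grind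
  have hba : b ≠ a := hab.symm
  refine ⟨y, y a, y b, ?_, ?_, ?_, ?_, ?_, ?_, ?_, ?_, ?_, ?_, ?_, ?_⟩
  · exact fun k hk => hy.lower k (by simp [hk])
  · exact fun k hk => hy.upper k (by simp [hk])
  · exact hy.lower a (by simp)
  · exact hy.root
  · exact hy.lower b (by simp)
  · exact hy.upper b (by simp)
  · exact hy.edge b (by simp) ((extension_adj_left hba).2 (Or.inl rfl))
  · have := hy.total
    rw [sum_insert haU, sum_insert hbK] at this
    linarith
  · intro k hk x hxX hxb hadj
    have := hy.edge k (by simp [hk]) ((extension_adj_left (hKa k hk)).2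
      (Or.inr ⟨x, hxX, hxb, hadj⟩))
    linarith
  · intro p hp q hq r hr hpq hqr hpr hflat
    refine hy.triangle p (hmem p hp) q (hmem q hq) r (hmem r hr)
      ((extension_adj (hKa p hp) (hKa q hq)).2 hpq) ((extension_adj (hKa q hq) (hKa r hr)).2 hqr)
      ((extension_adj (hKa p hp) (hKa r hr)).2 hpr) fun hm => hflat ?_
    have hT : ({p, q, r} : Finset V) ⊆ K := by grind
    obtain ⟨k, hk, hadj, hm'⟩ := hm.exists_partner (x := a) (by grind)
    rw [matchable_extension_iff (by grind)] at hm'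
    have hka := hadj.ne'
    rcases (extension_adj_left hka).1 hadj with rfl | ⟨x, hxX, hxb, hxk⟩
    · exact h.matchable_sdiff hT (hm'.congr (by grind))
    · rcases ne_or_eq k b with hkb | rfl
      · obtain ⟨k', hk', hadj', hm''⟩ := hm'.exists_partner (x := b) (by grind)
        have hkb' := hadj'.ne'
        refine h.matchable_of_cross_two hT (k := k) (k' := k') (by grind) (by grind) hxX hbX hxk hadj'
          (by grind) hxb (by grind) (by grind) (hm''.congr (by grind))
      · exact h.matchable_sdiff hT (hm'.congr (by grind))
  · intro p hp q hq hpq hno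
    refine hy.pair p (hmem p hp) q (hmem q hq) ((extension_adj (hKa p hp) (hKa q hq)).2 hpq)
      fun hm => ?_
    rw [matchable_extension_iff (by grind)] at hm
    obtain ⟨k, hk, hadj, hm'⟩ := hm.exists_partner (x := b) (by grind)
    have := hadj.ne
    exact hno k (by grind) (by grind) (by grind) hadj (hm'.congr (by grind))
  · intro p hp q hq hpq hbp hbq hno
    have := hy.triangle p (hmem p hp) q (hmem q hq) b hbmem
      ((extension_adj (hKa p hp) (hKa q hq)).2 hpq) ((extension_adj (hKa q hq) hba).2 hbq.symm)
      ((extension_adj (hKa p hp) hba).2 hbp.symm) fun hm => by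
        obtain ⟨k, hk, hadj, hm'⟩ := hm.exists_partner (x := a) (by grind)
        rw [matchable_extension_iff (by grind)] at hm'
        have hka := hadj.ne'
        rcases (extension_adj_left hka).1 hadj with rfl | ⟨x, hxX, hxb, hxk⟩
        · grind
        · exact hno k (by grind) (by grind) (by grind) x hxX hxb hxk (hm'.congr (by grind))
    linarith

/-- A weight supported on an end `K` and one of its attachments. -/
structure EndWeight (G : SimpleGraph V) (C K X : Finset V) (b : V) (z : V → ℤ) : Prop where
  lower : ∀ v, -1 ≤ z v
  upper : ∀ v, z v ≤ 1
  nonpos : ∀ v, v ∉ K → z v ≤ 0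
  zero : ∀ v, v ∉ K → v ≠ b → z v = 0
  total : 1 ≤ ∑ v ∈ C, z v
  triangle : ∀ p ∈ C, ∀ q ∈ C, ∀ r ∈ C, TriangleBound G C z p q r
  pair : ∀ p ∈ K, ∀ q ∈ K, G.Adj p q → (∀ k ∈ K, k ≠ p → k ≠ q → G.Adj b k →
    ¬ Matchable G (K \ {k, p, q})) → z p + z q ≤ 0

/-- A triangle with exactly one vertex in `K` is never flat, since that vertex and any two
attachments can be deleted. Triangles with two or three vertices in `K` are covered by the end
values, and outside `K` the weight is nonpositive. -/
theorem IsEnd.exists_endWeight {C K X : Finset V} (h : IsEnd G C K X)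
    (hIH : HasRootedWeights V C.card) (hlt : K.card + 2 < C.card) {a b : V} (ha : a ∈ X)
    (hbX : b ∈ X) (hab : a ≠ b) (hb : ∃ k ∈ K, G.Adj b k)
    (hx : ∃ x ∈ X, x ≠ b ∧ ∃ k ∈ K, G.Adj x k) : ∃ z, EndWeight G C K X b z := by
  obtain ⟨y, A, B, hy⟩ := h.exists_endValues hIH hlt ha hbX hab hb hx
  have hbK := h.notMem b hbX
  have hA2 := hy.upper_left
  have hB1 := hy.lower_right
  have hAB := hy.add_le
  -- Discarding `A` and truncating `B` at 0 keeps the total: `A ≤ 0` and `A + B ≤ 0` give `A + B ≤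
  -- min B 0`.
  let z : V → ℤ := fun v => if v ∈ K then y v else if v = b then min B 0 else 0
  have hzK : ∀ v ∈ K, z v = y v := fun v hv => by simp [z, hv]
  have hzb : z b = min B 0 := by simp [z, hbK]
  have hz0 : ∀ v, v ∉ K → v ≠ b → z v = 0 := fun v hv hvb => by simp [z, hv, hvb]
  have hneg : ∀ v, v ∉ K → z v ≤ 0 := by
    intro v hv
    by_cases hvb : v = b
    · subst hvb; rw [hzb]; exact min_le_right _ _
    · rw [hz0 v hv hvb]
  refine ⟨z, ?_, ?_, hneg, hz0, ?_, ?_, ?_⟩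
  · intro v
    by_cases hv : v ∈ K
    · rw [hzK v hv]; exact hy.lower v hv
    by_cases hvb : v = b
    · subst hvb; rw [hzb]; omega
    · rw [hz0 v hv hvb]; omega
  · intro v
    by_cases hv : v ∈ K
    · rw [hzK v hv]; exact hy.upper v hv
    · exact (hneg v hv).trans (by omega)
  · have h1 : ∑ v ∈ C, z v = ∑ v ∈ insert b K, z v := by
      refine (sum_subset (insert_subset (h.subset hbX) h.sub) ?_).symm
      intro v _ hv
      rw [mem_insert, not_or] at hv
      exact hz0 v hv.2 hv.1
    have h2 : ∑ v ∈ K, z v = ∑ k ∈ K, y k := sum_congr rfl hzK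
    rw [h1, sum_insert hbK, hzb, h2]
    have := hy.total
    omega
  · refine triangleBound_of_sorted (fun v => if v ∈ K then 0 else 1) ?_
    intro p hp q hq r hr h1 h2 hpq hqr hpr hflat
    by_cases hpK : p ∈ K
    swap
    · have hqK : q ∉ K := by intro hq; simp [hpK, hq] at h1
      have hrK : r ∉ K := by intro hr; simp [hqK, hr] at h2
      have := hneg p hpK; have := hneg q hqK; have := hneg r hrK
      omega
    by_cases hrK : r ∈ K
    · have hqK : q ∈ K := by by_contra hq; simp [hq, hrK] at h2
      rw [hzK p hpK, hzK q hqK, hzK r hrK]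
      exact hy.triangle p hpK q hqK r hrK hpq hqr hpr hflat
    have hrX : r ∈ X := (h.closed p hpK r hr hpr).resolve_left hrK
    by_cases hqK : q ∈ K
    swap
    · have hqX : q ∈ X := (h.closed p hpK q hq hpq).resolve_left hqK
      exact absurd (h.matchable_sdiff_pair hpK hqX hrX hqr.ne) hflat
    rw [hzK p hpK, hzK q hqK]
    by_cases hrb : r = b
    · subst hrb
      have := hy.pair_right p hpK q hqK hpq hpr.symm hqr.symm (h.not_matchable_of_cross hpK hqK hrX hflat)
      rw [hzb]
      have := hy.upper p hpK
      have := hy.upper q hqK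
      by_cases hB : B ≤ 0
      · rw [min_eq_left hB]; omega
      · rw [min_eq_right (by omega)]; omega
    · have := hy.pair p hpK q hqK hpq (fun k hk hkp hkq hadj =>
        h.not_matchable_of_cross hpK hqK hrX hflat k hk hkp hkq b hbX (Ne.symm hrb) hadj)
      have := hneg r hrK
      omega
  · intro p hp q hq hpq hno
    rw [hzK p hp, hzK q hq]
    exact hy.pair p hp q hq hpq hno

/-! ### Ends with two attachments. -/

/-- The graph in which `a` takes over the neighbours of `b`. -/
def collapse (G : SimpleGraph V) (a b : V) : SimpleGraph V :=
  SimpleGraph.fromRel fun u v => (u ≠ a ∧ v ≠ a ∧ G.Adj u v) ∨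
    (u = a ∧ (G.Adj a v ∨ G.Adj b v))

lemma collapse_adj {a b u v : V} (hu : u ≠ a) (hv : v ≠ a) :
    (collapse G a b).Adj u v ↔ G.Adj u v := by
  simp only [collapse, SimpleGraph.fromRel_adj]
  constructor
  · rintro ⟨-, h | h⟩
    · rcases h with h | h
      · exact h.2.2
      · exact absurd h.1 hu
    · rcases h with h | h
      · exact h.2.2.symm
      · exact absurd h.1 hv
  · intro h
    exact ⟨h.ne, Or.inl (Or.inl ⟨hu, hv, h⟩)⟩

lemma collapse_adj_left {a b v : V} (hv : v ≠ a) :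
    (collapse G a b).Adj a v ↔ G.Adj a v ∨ G.Adj b v := by
  simp only [collapse, SimpleGraph.fromRel_adj]
  constructor
  · rintro ⟨-, h | h⟩
    · rcases h with h | h
      · exact absurd rfl h.1
      · exact h.2
    · rcases h with h | h
      · exact absurd rfl h.2.1
      · exact absurd h.1 hv
  · intro h
    exact ⟨hv.symm, Or.inl (Or.inr ⟨trivial, h⟩)⟩

lemma matchable_collapse_iff {U : Finset V} {a b : V} (ha : a ∉ U) :
    Matchable (collapse G a b) U ↔ Matchable G U := by
  have key : ∀ u ∈ U, ∀ v ∈ U, (collapse G a b).Adj u v ↔ G.Adj u v := fun u hu v hv =>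
    collapse_adj (by rintro rfl; exact ha hu) (by rintro rfl; exact ha hv)
  exact ⟨fun h => h.mono fun u hu v hv => (key u hu v hv).1,
    fun h => h.mono fun u hu v hv => (key u hu v hv).2⟩

/-- An end `K` attached to exactly two vertices `a` and `b`, with further vertices `W` beyond. -/
structure TwoEnd (G : SimpleGraph V) (C K W : Finset V) (a b : V) : Prop where
  fc : FactorCritical G C
  isEnd : IsEnd G C K {a, b}
  ne : a ≠ b
  adj_left : ∃ k ∈ K, G.Adj a k
  adj_right : ∃ k ∈ K, G.Adj b k
  eq : W = (C \ K) \ {a, b}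
  nonempty : W.Nonempty

namespace TwoEnd

variable {C K W : Finset V} {a b : V}

lemma symm (h : TwoEnd G C K W a b) : TwoEnd G C K W b a :=
  ⟨h.fc, by rw [pair_comm]; exact h.isEnd, h.ne.symm, h.adj_right, h.adj_left,
    by rw [pair_comm]; exact h.eq, h.nonempty⟩

lemma left_notMem (h : TwoEnd G C K W a b) : a ∉ K := h.isEnd.notMem a (by simp)

lemma right_notMem (h : TwoEnd G C K W a b) : b ∉ K := h.isEnd.notMem b (by simp)

lemma left_mem (h : TwoEnd G C K W a b) : a ∈ C := h.isEnd.subset (by simp)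

lemma right_mem (h : TwoEnd G C K W a b) : b ∈ C := h.isEnd.subset (by simp)

lemma mem_rest (h : TwoEnd G C K W a b) {v : V} : v ∈ W ↔ v ∈ C ∧ v ∉ K ∧ v ≠ a ∧ v ≠ b := by
  rw [h.eq]; simp only [mem_sdiff, mem_insert, mem_singleton]; tauto

lemma not_adj (h : TwoEnd G C K W a b) {k w : V} (hk : k ∈ K) (hw : w ∈ W) : ¬ G.Adj k w := by
  intro hadj
  have hw' := h.mem_rest.1 hw
  rcases h.isEnd.closed k hk w hw'.1 hadj with h1 | h1
  · exact hw'.2.1 h1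
  · simp only [mem_insert, mem_singleton] at h1
    tauto

lemma matchable_rest (h : TwoEnd G C K W a b) : Matchable G W := by
  rw [h.eq]; exact h.isEnd.matchable_pair a (by simp) b (by simp) h.ne

lemma matchable_insert_right (h : TwoEnd G C K W a b) : Matchable G (insert b K) := by
  obtain ⟨k, hk, hadj⟩ := h.adj_right
  exact h.isEnd.fc.matchable_insert h.right_notMem hk hadj

lemma card_eq (h : TwoEnd G C K W a b) : C.card = K.card + W.card + 2 := by
  have h1 : C = K ∪ (W ∪ {a, b}) := by
    ext v
    have := h.mem_rest (v := v)
    have := h.left_mem; have := h.right_mem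
    have := h.isEnd.sub
    grind
  have h2 : Disjoint K (W ∪ {a, b}) := by
    rw [disjoint_left]
    intro v hv
    have := h.mem_rest (v := v)
    have := h.left_notMem; have := h.right_notMem
    grind
  have h3 : Disjoint W {a, b} := by
    rw [disjoint_left]
    intro v hv
    have := h.mem_rest (v := v)
    grind
  rw [h1, card_union_of_disjoint h2, card_union_of_disjoint h3, card_pair h.ne]
  omega

/-- Once `w` is deleted, `K` and `W.erase w` are two odd sets behind `{a, b}`. The barrier is tight,
so each uses up one of the two attachments. -/
lemma exists_attach (h : TwoEnd G C K W a b) {w : V} (hw : w ∈ W) :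
    Matchable G (insert a (W.erase w)) ∨ Matchable G (insert b (W.erase w)) := by
  have hw' := h.mem_rest.1 hw
  have hB : Barrier G C {a, b} {K} := by
    constructor
    · exact h.isEnd.subset
    · intro L hL; rw [mem_singleton.1 hL]; exact h.isEnd.sub
    · intro L hL k hk hmem; rw [mem_singleton.1 hL] at hk; exact h.isEnd.notMem k hmem hk
    · intro L hL; rw [mem_singleton.1 hL]; exact h.isEnd.fc.odd_card
    · intro L hL M hM _ _ _; rw [mem_singleton.1 hL, mem_singleton.1 hM]
    · intro L hL; rw [mem_singleton.1 hL]; exact h.isEnd.closed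
  have hBw := hB.erase (c := w) (fun L hL => by rw [mem_singleton.1 hL]; exact hw'.2.1)
  rw [erase_eq_of_notMem (s := {a, b}) (a := w) (by simp [hw'.2.2])] at hBw
  have hrw : Barrier.rest (C.erase w) {a, b} {K} = W.erase w := by
    ext z
    simp only [Barrier.mem_rest, mem_erase, h.mem_rest, mem_insert, mem_singleton, forall_eq]
    tauto
  have hodd : Odd (Barrier.rest (C.erase w) {a, b} {K}).card := by
    rw [hrw, card_erase_of_mem hw]
    have := card_pos.2 ⟨w, hw⟩
    obtain ⟨m, hm⟩ := h.matchable_rest.even_card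
    exact ⟨m - 1, by omega⟩
  obtain ⟨s, hs, hsm⟩ := ((hBw.add_rest hodd).tight (h.fc.2 w hw'.1) (by
    rw [Barrier.card_add_rest hodd, card_pair h.ne, card_singleton])).1 _ (mem_insert_self _ _)
  rw [hrw] at hsm
  simp only [mem_insert, mem_singleton] at hs
  rcases hs with rfl | rfl
  · exact Or.inl hsm
  · exact Or.inr hsm

/-- Whichever attachment can be matched with `W.erase v`, the merged vertex inherits its edge. -/
lemma factorCritical_collapse (h : TwoEnd G C K W a b) :
    FactorCritical (collapse G a b) (insert a W) := by
  have haW : a ∉ W := fun h' => (h.mem_rest.1 h').2.2.1 rfl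
  refine ⟨⟨a, by simp⟩, fun v hv => ?_⟩
  rcases mem_insert.1 hv with rfl | hv
  · rw [erase_insert haW, matchable_collapse_iff haW]
    exact h.matchable_rest
  have hva : v ≠ a := (h.mem_rest.1 hv).2.2.1
  have key : ∃ u ∈ W.erase v, (G.Adj a u ∨ G.Adj b u) ∧ Matchable G ((W.erase v).erase u) := by
    have hbW : b ∉ W := fun h' => (h.mem_rest.1 h').2.2.2 rfl
    rcases h.exists_attach hv with hm | hm
    · obtain ⟨u, hu, hadj, hm'⟩ := hm.exists_partner (x := a) (by simp)
      have := hadj.ne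
      exact ⟨u, by grind, Or.inl hadj, hm'.congr (by grind)⟩
    · obtain ⟨u, hu, hadj, hm'⟩ := hm.exists_partner (x := b) (by simp)
      have := hadj.ne
      exact ⟨u, by grind, Or.inr hadj, hm'.congr (by grind)⟩
  obtain ⟨u, hu, hadj, hm⟩ := key
  refine (matchable_pair ((collapse_adj_left (a := a) (b := b) (v := u) (by grind)).2
    hadj)).of_parts ((matchable_collapse_iff (by grind)).2 hm) ?_ ?_ <;> grind

/-- The edge at the merged vertex comes from `a` or from `b`; the attachment not used is matched
together with `K`. -/
lemma matchable_of_collapse (h : TwoEnd G C K W a b) {T : Finset V} (hT : T ⊆ W)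
    (hm : Matchable (collapse G a b) (insert a W \ T)) : Matchable G (C \ T) := by
  have haW : a ∉ W := fun h' => (h.mem_rest.1 h').2.2.1 rfl
  obtain ⟨u, hu, hadj, hm'⟩ := hm.exists_partner (x := a) (by grind)
  have hua := hadj.ne'
  rw [collapse_adj_left hua] at hadj
  rw [matchable_collapse_iff (by grind)] at hm'
  have huW : u ∈ W := by grind
  have hmem := fun v => h.mem_rest (v := v)
  have h1 := h.left_mem; have h2 := h.right_mem; have h3 := h.isEnd.sub
  have h4 := h.left_notMem; have h5 := h.right_notMem; have h6 := h.ne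
  have hTW : ∀ v ∈ T, v ∈ W := hT
  have hKC : ∀ v ∈ K, v ∈ C := h3
  clear hT h3
  rcases hadj with hadj | hadj
  · refine ((matchable_pair hadj).of_parts hm' (U := insert a W \ T) ?_ ?_).of_parts
      h.matchable_insert_right ?_ ?_
    · grind
    · grind
    · intro v
      simp only [mem_sdiff, mem_insert, hmem]
      grind
    · grind
  · refine ((matchable_pair hadj).of_parts hm' (U := insert b W \ T) ?_ ?_).of_parts
      h.symm.matchable_insert_right ?_ ?_
    · grind
    · grind
    · intro v
      simp only [mem_sdiff, mem_insert, hmem]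
      grind
    · grind

lemma matchable_sdiff_insert (h : TwoEnd G C K W a b) {T : Finset V} (hT : T ⊆ W)
    (hm : Matchable G (W \ T)) : Matchable G (C \ insert a T) := by
  have hmem := fun v => h.mem_rest (v := v)
  have h1 := h.left_mem; have h2 := h.right_mem
  have h4 := h.left_notMem; have h5 := h.right_notMem; have h6 := h.ne
  have hTW : ∀ v ∈ T, v ∈ W := hT
  have hKC : ∀ v ∈ K, v ∈ C := h.isEnd.sub
  clear hT
  refine hm.of_parts h.matchable_insert_right ?_ ?_
  · intro v
    simp only [mem_sdiff, mem_insert, hmem]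
    grind
  · grind

end TwoEnd

/-- A weight on the part `W` beyond a two-vertex attachment, with value `R` for the attachment. -/
structure RestValues (G : SimpleGraph V) (C W : Finset V) (a b : V) (y : V → ℤ) (R : ℤ) :
    Prop where
  lower : ∀ w ∈ W, -1 ≤ y w
  upper : ∀ w ∈ W, y w ≤ 1
  lower_root : -1 ≤ R
  upper_root : R ≤ 0
  total : 1 ≤ ∑ w ∈ W, y w + R
  edge : ∀ w ∈ W, G.Adj a w ∨ G.Adj b w → R + y w ≤ 0
  pair : ∀ p ∈ W, ∀ q ∈ W, G.Adj p q → ¬ Matchable G (W \ {p, q}) → y p + y q ≤ 0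
  triangle : ∀ p ∈ W, ∀ q ∈ W, ∀ r ∈ W, TriangleBound G C y p q r

/-- The induction hypothesis for the collapsed graph, rooted at the merged vertex, whose value is
`R`. -/
theorem TwoEnd.exists_restValues {C K W : Finset V} {a b : V} (h : TwoEnd G C K W a b)
    (hIH : HasRootedWeights V C.card) : ∃ y R, RestValues G C W a b y R := by
  have haW : a ∉ W := fun h' => (h.mem_rest.1 h').2.2.1 rfl
  have hc := h.card_eq
  have hpos := card_pos.2 h.nonempty
  have hWe := h.matchable_rest.even_card
  have hci := card_insert_of_notMem haW
  obtain ⟨y, hy⟩ := hIH (collapse G a b) (insert a W) a (by omega) h.factorCritical_collapse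
    (by obtain ⟨m, hm⟩ := hWe; omega) (by simp)
  have hWa : ∀ w ∈ W, w ≠ a := by rintro w hw rfl; exact haW hw
  have hm : ∀ w ∈ W, w ∈ (insert a W).erase a := by grind
  refine ⟨y, y a, ?_, ?_, ?_, hy.root, ?_, ?_, ?_, ?_⟩
  · exact fun w hw => hy.lower w (by simp [hw])
  · exact fun w hw => hy.upper w (by simp [hw])
  · exact hy.lower a (by simp)
  · have := hy.total
    rw [sum_insert haW] at this
    linarith
  · exact fun w hw hadj => hy.edge w (by simp [hw]) ((collapse_adj_left (hWa w hw)).2 hadj)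
  · intro p hp q hq hpq hflat
    refine hy.pair p (hm p hp) q (hm q hq) ((collapse_adj (hWa p hp) (hWa q hq)).2 hpq)
      fun hmm => hflat ?_
    rw [matchable_collapse_iff (by simp)] at hmm
    exact hmm.congr (by grind)
  · intro p hp q hq r hr hpq hqr hpr hflat
    exact hy.triangle p (hm p hp) q (hm q hq) r (hm r hr)
      ((collapse_adj (hWa p hp) (hWa q hq)).2 hpq) ((collapse_adj (hWa q hq) (hWa r hr)).2 hqr)
      ((collapse_adj (hWa p hp) (hWa r hr)).2 hpr) fun hmm =>
        hflat (h.matchable_of_collapse (by grind) hmm)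

/-! ### Gluing weights across two attachments. -/

/-- The weight equal to `yK` on `K`, `α` at `a`, `β` at `b` and `yW` elsewhere. -/
def glue (K : Finset V) (a b : V) (yK : V → ℤ) (α β : ℤ) (yW : V → ℤ) : V → ℤ :=
  fun v => if v ∈ K then yK v else if v = a then α else if v = b then β else yW v

namespace TwoEnd

variable {C K W : Finset V} {a b : V} {yK yW : V → ℤ} {α β : ℤ}

lemma glue_mem {v : V} (hv : v ∈ K) : glue K a b yK α β yW v = yK v := by simp [glue, hv]

lemma glue_left (h : TwoEnd G C K W a b) : glue K a b yK α β yW a = α := by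
  simp [glue, h.left_notMem]

lemma glue_right (h : TwoEnd G C K W a b) : glue K a b yK α β yW b = β := by
  simp [glue, h.right_notMem, h.ne.symm]

lemma glue_rest (h : TwoEnd G C K W a b) {w : V} (hw : w ∈ W) :
    glue K a b yK α β yW w = yW w := by
  have := h.mem_rest.1 hw
  simp [glue, this]

lemma cases (h : TwoEnd G C K W a b) {v : V} (hv : v ∈ C) : v ∈ K ∨ v = a ∨ v = b ∨ v ∈ W := by
  rw [h.mem_rest]; tauto

lemma sum_glue (h : TwoEnd G C K W a b) :
    ∑ v ∈ C, glue K a b yK α β yW v = ∑ k ∈ K, yK k + α + β + ∑ w ∈ W, yW w := by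
  have h1 : C = insert a (insert b (K ∪ W)) := by
    ext v
    have := h.mem_rest (v := v)
    have := h.left_mem; have := h.right_mem
    have := h.isEnd.sub
    grind
  have h2 : Disjoint K W := by
    rw [disjoint_left]
    intro v hv hw
    exact (h.mem_rest.1 hw).2.1 hv
  have hmem := fun v => h.mem_rest (v := v)
  have h3 : b ∉ K ∪ W := by
    rw [mem_union, hmem]; have := h.right_notMem; tauto
  have h4 : a ∉ insert b (K ∪ W) := by
    rw [mem_insert, mem_union, hmem]; have := h.left_notMem; have := h.ne; tauto
  rw [h1, sum_insert h4, sum_insert h3, sum_union h2, h.glue_left, h.glue_right,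
    sum_congr rfl (fun v hv => glue_mem hv), sum_congr rfl (fun v hv => h.glue_rest hv)]
  ring

lemma le_glue (h : TwoEnd G C K W a b) {m : ℤ} (hK : ∀ k ∈ K, m ≤ yK k) (hα : m ≤ α) (hβ : m ≤ β)
    (hW : ∀ w ∈ W, m ≤ yW w) : ∀ v ∈ C, m ≤ glue K a b yK α β yW v := by
  intro v hv
  rcases h.cases hv with hv | rfl | rfl | hv
  · rw [glue_mem hv]; exact hK v hv
  · rwa [h.glue_left]
  · rwa [h.glue_right]
  · rw [h.glue_rest hv]; exact hW v hv

lemma glue_le (h : TwoEnd G C K W a b) {m : ℤ} (hK : ∀ k ∈ K, yK k ≤ m) (hα : α ≤ m) (hβ : β ≤ m)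
    (hW : ∀ w ∈ W, yW w ≤ m) : ∀ v ∈ C, glue K a b yK α β yW v ≤ m := by
  intro v hv
  rcases h.cases hv with hv | rfl | rfl | hv
  · rw [glue_mem hv]; exact hK v hv
  · rwa [h.glue_left]
  · rwa [h.glue_right]
  · rw [h.glue_rest hv]; exact hW v hv

/-- The position of a vertex in the order `K`, `a`, `b`, `W`. -/
def rank (K : Finset V) (a b : V) (v : V) : ℕ :=
  if v ∈ K then 0 else if v = a then 1 else if v = b then 2 else 3

lemma rank_mem {v : V} (hv : v ∈ K) : rank K a b v = 0 := by simp [rank, hv]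

lemma rank_left (h : TwoEnd G C K W a b) : rank K a b a = 1 := by simp [rank, h.left_notMem]

lemma rank_right (h : TwoEnd G C K W a b) : rank K a b b = 2 := by
  simp [rank, h.right_notMem, h.ne.symm]

lemma rank_rest (h : TwoEnd G C K W a b) {w : V} (hw : w ∈ W) : rank K a b w = 3 := by
  have := h.mem_rest.1 hw
  simp [rank, this]

/-- No edge joins `K` to `W`, and a triangle formed by `a`, `b` and a vertex of `K` is not flat. In
rank order this leaves seven types of triangle. -/
lemma triangleBound_glue (h : TwoEnd G C K W a b) {D : Finset V} (hD : D ⊆ C)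
    (hKKK : ∀ p ∈ K, ∀ q ∈ K, ∀ r ∈ K, p ∈ D → q ∈ D → r ∈ D → TriangleBound G C yK p q r)
    (hKKa : a ∈ D → ∀ p ∈ K, ∀ q ∈ K, p ∈ D → q ∈ D → G.Adj p q → G.Adj a p → G.Adj a q →
      ¬ Matchable G (C \ {p, q, a}) → yK p + yK q + α ≤ 0)
    (hKKb : b ∈ D → ∀ p ∈ K, ∀ q ∈ K, p ∈ D → q ∈ D → G.Adj p q → G.Adj b p → G.Adj b q →
      ¬ Matchable G (C \ {p, q, b}) → yK p + yK q + β ≤ 0)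
    (habW : a ∈ D → b ∈ D → ∀ w ∈ W, w ∈ D → G.Adj a w → G.Adj b w → α + β + yW w ≤ 0)
    (haWW : a ∈ D → ∀ p ∈ W, ∀ q ∈ W, p ∈ D → q ∈ D → G.Adj p q → G.Adj a p → G.Adj a q →
      ¬ Matchable G (W \ {p, q}) → α + yW p + yW q ≤ 0)
    (hbWW : b ∈ D → ∀ p ∈ W, ∀ q ∈ W, p ∈ D → q ∈ D → G.Adj p q → G.Adj b p → G.Adj b q →
      ¬ Matchable G (W \ {p, q}) → β + yW p + yW q ≤ 0)
    (hWWW : ∀ p ∈ W, ∀ q ∈ W, ∀ r ∈ W, p ∈ D → q ∈ D → r ∈ D → TriangleBound G C yW p q r) :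
    ∀ p ∈ D, ∀ q ∈ D, ∀ r ∈ D, TriangleBound G C (glue K a b yK α β yW) p q r := by
  refine triangleBound_of_sorted (rank K a b) ?_
  intro p hp q hq r hr hle₁ hle₂ hpq hqr hpr hflat
  rcases h.cases (hD hp) with hpc | rfl | rfl | hpc <;>
    rcases h.cases (hD hq) with hqc | rfl | rfl | hqc <;>
    rcases h.cases (hD hr) with hrc | rfl | rfl | hrc <;>
    (try simp only [rank_mem, h.rank_left, h.rank_right, h.rank_rest, *] at hle₁ hle₂) <;>
    (try (exfalso; omega)) <;> (try exact absurd hqr (h.not_adj hqc hrc)) <;>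
    (try exact absurd hpr (h.not_adj hpc hrc)) <;> (try exact absurd rfl hpq.ne) <;>
    (try exact absurd rfl hqr.ne) <;>
    (try simp only [glue_mem, h.glue_left, h.glue_right, h.glue_rest, *])
  · exact hKKK p hpc q hqc r hrc hp hq hr hpq hqr hpr hflat
  · exact hKKa hr p hpc q hqc hp hq hpq hpr.symm hqr.symm hflat
  · exact hKKb hr p hpc q hqc hp hq hpq hpr.symm hqr.symm hflat
  · exact absurd (h.isEnd.matchable_sdiff_pair hpc (by simp) (by simp) h.ne) hflat
  · exact haWW hp q hqc r hrc hq hr hqr hpq hpr fun hm =>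
      hflat (h.matchable_sdiff_insert (by grind) hm)
  · exact hbWW hp q hqc r hrc hq hr hqr hpq hpr fun hm =>
      hflat (h.symm.matchable_sdiff_insert (by grind) hm)
  · exact hWWW p hpc q hqc r hrc hp hq hr hpq hqr hpr hflat

lemma pairBound_glue (h : TwoEnd G C K W a b) {D : Finset V} {j : V} (hD : D ⊆ C)
    (hKK : ∀ p ∈ K, ∀ q ∈ K, p ∈ D → q ∈ D → PairBound G C j yK p q)
    (hKa : a ∈ D → ∀ k ∈ K, k ∈ D → G.Adj a k → ¬ Matchable G (C \ {j, k, a}) → yK k + α ≤ 0)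
    (hKb : b ∈ D → ∀ k ∈ K, k ∈ D → G.Adj b k → ¬ Matchable G (C \ {j, k, b}) → yK k + β ≤ 0)
    (hab : a ∈ D → b ∈ D → α + β ≤ 0)
    (haW : a ∈ D → ∀ w ∈ W, w ∈ D → G.Adj a w → ¬ Matchable G (C \ {j, a, w}) → α + yW w ≤ 0)
    (hbW : b ∈ D → ∀ w ∈ W, w ∈ D → G.Adj b w → ¬ Matchable G (C \ {j, b, w}) → β + yW w ≤ 0)
    (hWW : ∀ p ∈ W, ∀ q ∈ W, p ∈ D → q ∈ D → PairBound G C j yW p q) :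
    ∀ p ∈ D, ∀ q ∈ D, PairBound G C j (glue K a b yK α β yW) p q := by
  refine pairBound_of_sorted (rank K a b) ?_
  intro p hp q hq hle hpq hflat
  rcases h.cases (hD hp) with hpc | rfl | rfl | hpc <;>
    rcases h.cases (hD hq) with hqc | rfl | rfl | hqc <;>
    (try simp only [rank_mem, h.rank_left, h.rank_right, h.rank_rest, *] at hle) <;>
    (try (exfalso; omega)) <;> (try exact absurd hpq (h.not_adj hpc hqc)) <;>
    (try exact absurd rfl hpq.ne) <;>
    (try simp only [glue_mem, h.glue_left, h.glue_right, h.glue_rest, *])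
  · exact hKK p hpc q hqc hp hq hpq hflat
  · exact hKa hq p hpc hp hpq.symm hflat
  · exact hKb hq p hpc hp hpq.symm hflat
  · exact haW hp q hqc hq hpq hflat
  · exact hbW hp q hqc hq hpq hflat
  · exact hWW p hpc q hqc hp hq hpq hflat

end TwoEnd

namespace TwoEnd

variable {C K W : Finset V} {a b : V}

lemma card_lt (h : TwoEnd G C K W a b) : K.card + 2 < C.card := by
  have := h.card_eq
  have := card_pos.2 h.nonempty
  omega

lemma exists_endValues (h : TwoEnd G C K W a b) (hIH : HasRootedWeights V C.card) :
    ∃ y A B, EndValues G C K {a, b} b y A B :=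
  h.isEnd.exists_endValues hIH h.card_lt (a := a) (by simp) (by simp) h.ne h.adj_right
    ⟨a, by simp, h.ne, h.adj_left⟩

lemma exists_endWeight (h : TwoEnd G C K W a b) (hIH : HasRootedWeights V C.card) :
    ∃ z, EndWeight G C K {a, b} b z :=
  h.isEnd.exists_endWeight hIH h.card_lt (a := a) (by simp) (by simp) h.ne h.adj_right
    ⟨a, by simp, h.ne, h.adj_left⟩

lemma pair_left (h : TwoEnd G C K W a b) {y : V → ℤ} {A B : ℤ}
    (hy : EndValues G C K {a, b} b y A B) {p q : V} (hp : p ∈ K) (hq : q ∈ K) (hpq : G.Adj p q)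
    (hflat : ¬ Matchable G (C \ {p, q, a})) : y p + y q ≤ 0 :=
  hy.pair p hp q hq hpq fun k hk hkp hkq hadj =>
    h.isEnd.not_matchable_of_cross hp hq (by simp) hflat k hk hkp hkq b (by simp) h.ne.symm hadj

lemma pair_right (h : TwoEnd G C K W a b) {y : V → ℤ} {A B : ℤ}
    (hy : EndValues G C K {a, b} b y A B) {p q : V} (hp : p ∈ K) (hq : q ∈ K) (hpq : G.Adj p q)
    (hbp : G.Adj b p) (hbq : G.Adj b q)
    (hflat : ¬ Matchable G (C \ {p, q, b})) : y p + y q + B ≤ 0 :=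
  hy.pair_right p hp q hq hpq hbp hbq
    (h.isEnd.not_matchable_of_cross hp hq (by simp) hflat)

theorem exists_rootedWeight_left (h : TwoEnd G C K W a b) (hIH : HasRootedWeights V C.card) :
    ∃ y, RootedWeight G C a y := by
  obtain ⟨yK, A, B, hK⟩ := h.exists_endValues hIH
  obtain ⟨yW, R, hW⟩ := h.exists_restValues hIH
  have h1 := hK.lower_left; have h2 := hK.upper_left; have h3 := hK.lower_right
  have h4 := hK.upper_right; have h5 := hK.add_le; have h6 := hK.total
  have h7 := hW.lower_root; have h8 := hW.upper_root; have h9 := hW.total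
  have haC : a ∉ C.erase a := by simp
  -- The minima respect the bounds from both sides. The total stays at least 1 because the ranges of
  -- `A`, `B`, `R` and `A + B ≤ 0` give `A + B + R - 1 ≤ min A R + min B R`.
  refine ⟨glue K a b yK (min A R) (min B R) yW, ?_, ?_, ?_, ?_, ?_, ?_, ?_⟩
  · exact h.le_glue hK.lower (by omega) (by omega) hW.lower
  · exact h.glue_le hK.upper (by omega) (by omega) hW.upper
  · rw [h.glue_left]; omega
  · rw [h.sum_glue]; omega
  · intro k hk hadj
    rw [h.glue_left]
    rcases h.cases hk with hk | rfl | rfl | hk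
    · rw [glue_mem hk]
      have := hK.edge k hk a (by simp) h.ne hadj
      omega
    · exact absurd rfl hadj.ne
    · rw [h.glue_right]; omega
    · rw [h.glue_rest hk]
      have := hW.edge k hk (Or.inl hadj)
      omega
  · refine h.pairBound_glue (erase_subset _ _) ?_ (fun h' => absurd h' haC) ?_
      (fun h' => absurd h' haC) (fun h' => absurd h' haC) ?_ ?_
    · intro p hp q hq _ _ hpq hflat
      exact h.pair_left hK hp hq hpq fun hm => hflat (hm.congr (by grind))
    · intro _ k hk _ _ hflat
      exact absurd ((h.isEnd.matchable_sdiff_pair (x := a) (x' := b) hk (by simp) (by simp)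
        h.ne).congr (by grind)) hflat
    · intro _ w hw _ hadj _
      have := hW.edge w hw (Or.inr hadj)
      omega
    · intro p hp q hq _ _ hpq hflat
      exact hW.pair p hp q hq hpq fun hm => hflat (h.matchable_sdiff_insert (by grind) hm)
  · refine h.triangleBound_glue (erase_subset _ _) ?_ (fun h' => absurd h' haC) ?_
      (fun h' => absurd h' haC) (fun h' => absurd h' haC) ?_ ?_
    · intro p hp q hq r hr _ _ _
      exact hK.triangle p hp q hq r hr
    · intro _ p hp q hq _ _ hpq hbp hbq hflat
      have := h.pair_right hK hp hq hpq hbp hbq hflat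
      omega
    · intro _ p hp q hq _ _ hpq _ _ hflat
      have := hW.pair p hp q hq hpq hflat
      omega
    · intro p hp q hq r hr _ _ _
      exact hW.triangle p hp q hq r hr

theorem exists_rootedWeight_of_mem (h : TwoEnd G C K W a b) (hIH : HasRootedWeights V C.card)
    {j : V} (hj : j ∈ K) (hnp : ∀ p ∈ C.erase j, ∀ q ∈ C.erase j, G.Adj p q →
      Matchable G (C \ {j, p, q})) : ∃ y, RootedWeight G C j y := by
  obtain ⟨yW, R, hW⟩ := h.exists_restValues hIH
  have h7 := hW.lower_root; have h8 := hW.upper_root; have h9 := hW.total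
  -- The pair condition is vacuous, so `K` may carry no weight: `yW` together with `R`, placed once
  -- at `a`, already has total at least 1.
  refine ⟨glue K a b 0 R 0 yW, ?_, ?_, ?_, ?_, ?_, ?_, ?_⟩
  · exact h.le_glue (by simp) (by omega) (by omega) hW.lower
  · exact h.glue_le (by simp) (by omega) (by omega) hW.upper
  · rw [glue_mem hj]; simp
  · rw [h.sum_glue]; simp; omega
  · intro k hk hadj
    rw [glue_mem hj]
    rcases h.cases hk with hk | rfl | rfl | hk
    · rw [glue_mem hk]; simp
    · rw [h.glue_left]; simpa using h8
    · rw [h.glue_right]; simp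
    · exact absurd hadj (h.not_adj hj hk)
  · exact fun p hp q hq hpq hflat => absurd (hnp p hp q hq hpq) hflat
  · refine h.triangleBound_glue (erase_subset _ _) ?_ ?_ ?_ ?_ ?_ ?_ ?_
    · intro p hp q hq r hr _ _ _ _ _ _ _
      simp
    · intros; simpa using h8
    · intros; simp
    · intro _ _ w hw _ haw _
      have := hW.edge w hw (Or.inl haw)
      omega
    · intro _ p hp q hq _ _ hpq _ _ hflat
      have := hW.pair p hp q hq hpq hflat
      omega
    · intro _ p hp q hq _ _ hpq _ _ hflat
      have := hW.pair p hp q hq hpq hflat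
      omega
    · intro p hp q hq r hr _ _ _
      exact hW.triangle p hp q hq r hr

/-- With `a` taking the place of `j` in `W`, the edge `b k` and a matching of `K \ {k, p, q}` would
match `C \ {j, p, q}`. -/
lemma not_matchable_of_flat_rest (h : TwoEnd G C K W a b) {j : V} (hj : j ∈ W)
    (ha : Matchable G (insert a (W.erase j))) {p q : V} (hp : p ∈ K) (hq : q ∈ K)
    (hflat : ¬ Matchable G (C \ {j, p, q})) :
    ∀ k ∈ K, k ≠ p → k ≠ q → G.Adj b k → ¬ Matchable G (K \ {k, p, q}) := by
  intro k hk hkp hkq hadj hm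
  have hmem := fun v => h.mem_rest (v := v)
  have hj' := (hmem j).1 hj
  have h1 := h.left_mem; have h4 := h.left_notMem; have h5 := h.right_notMem; have h6 := h.ne
  refine hflat (h.isEnd.matchable_of_cross (x := b) hk (by simp) hadj (hm.congr ?_) ?_ ?_
    (ha.congr ?_))
  · grind
  · grind
  · grind
  · intro v
    simp only [mem_sdiff, mem_insert, mem_singleton, mem_erase, hmem]
    grind

lemma matchable_sdiff_of_rest (h : TwoEnd G C K W a b) {j k : V} (hj : j ∈ W)
    (ha : Matchable G (insert a (W.erase j))) (hk : k ∈ K) : Matchable G (C \ {j, k, b}) := by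
  have hmem := fun v => h.mem_rest (v := v)
  have hj' := (hmem j).1 hj
  have h1 := h.left_mem; have h4 := h.left_notMem; have h5 := h.right_notMem; have h6 := h.ne
  have hKC : ∀ v ∈ K, v ∈ C := h.isEnd.sub
  refine (h.isEnd.fc.2 k hk).of_parts ha ?_ ?_
  · intro v
    simp only [mem_sdiff, mem_insert, mem_singleton, mem_erase, hmem]
    grind
  · intro v
    simp only [mem_insert, mem_erase, hmem]
    grind

/-- If either attachment can replace `j` in `W`, no edge between `K` and an attachment is flat with
`j`. The end weight alone then suffices. -/
theorem exists_rootedWeight_rest_both (h : TwoEnd G C K W a b)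
    (hIH : HasRootedWeights V C.card) {j : V} (hj : j ∈ W)
    (ha : Matchable G (insert a (W.erase j))) (hb : Matchable G (insert b (W.erase j))) :
    ∃ y, RootedWeight G C j y := by
  obtain ⟨z, hz⟩ := h.exists_endWeight hIH
  have hj' := h.mem_rest.1 hj
  have hjz : z j = 0 := hz.zero j hj'.2.1 hj'.2.2.2
  refine ⟨z, fun v _ => hz.lower v, fun v _ => hz.upper v, hjz.le, hz.total, ?_, ?_, ?_⟩
  · intro k hk hadj
    have hkK : k ∉ K := fun hkK => h.not_adj hkK hj hadj.symm
    have := hz.nonpos k hkK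
    omega
  · refine pairBound_of_sorted (fun v => if v ∈ K then 0 else 1) ?_
    intro p hp q hq hle hpq hflat
    by_cases hpK : p ∈ K
    swap
    · have hqK : q ∉ K := by intro hq; simp [hpK, hq] at hle
      have := hz.nonpos p hpK; have := hz.nonpos q hqK
      omega
    by_cases hqK : q ∈ K
    · exact hz.pair p hpK q hqK hpq (h.not_matchable_of_flat_rest hj ha hpK hqK hflat)
    have hqX := (h.isEnd.closed p hpK q (mem_erase.1 hq).2 hpq).resolve_left hqK
    simp only [mem_insert, mem_singleton] at hqX
    rcases hqX with rfl | rfl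
    · exact absurd (h.symm.matchable_sdiff_of_rest hj hb hpK) hflat
    · exact absurd (h.matchable_sdiff_of_rest hj ha hpK) hflat
  · intro p hp q hq r hr
    exact hz.triangle p (mem_erase.1 hp).2 q (mem_erase.1 hq).2 r (mem_erase.1 hr).2

/-- When only `a` can replace `j`, the end weight no longer suffices. It is glued to a weight on the
collapsed graph rooted at `j` itself. -/
theorem exists_rootedWeight_rest_one (h : TwoEnd G C K W a b)
    (hIH : HasRootedWeights V C.card) {j : V} (hj : j ∈ W)
    (ha : Matchable G (insert a (W.erase j))) (hb : ¬ Matchable G (insert b (W.erase j))) :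
    ∃ y, RootedWeight G C j y := by
  obtain ⟨yK, A, B, hK⟩ := h.exists_endValues hIH
  have haW : a ∉ W := fun h' => (h.mem_rest.1 h').2.2.1 rfl
  have hbW : b ∉ W := fun h' => (h.mem_rest.1 h').2.2.2 rfl
  have hc := h.card_eq
  have hpos := card_pos.2 h.nonempty
  have hWe := h.matchable_rest.even_card
  have hci := card_insert_of_notMem haW
  obtain ⟨yW, hW⟩ := hIH (collapse G a b) (insert a W) j (by
    have := card_pos.2 h.isEnd.fc.1; omega) h.factorCritical_collapse
    (by obtain ⟨m, hm⟩ := hWe; omega) (by simp [hj])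
  have hWa : ∀ w ∈ W, w ≠ a := by rintro w hw rfl; exact haW hw
  have hja := hWa j hj
  have hm : ∀ w ∈ W, w ≠ j → w ∈ (insert a W).erase j := by grind
  have ham : a ∈ (insert a W).erase j := by grind
  have h1 := hK.lower_left; have h2 := hK.upper_left; have h3 := hK.lower_right
  have h4 := hK.upper_right; have h5 := hK.add_le; have h6 := hK.total
  have h7 := hW.lower a (by simp); have h8 := hW.upper a (by simp); have h9 := hW.total
  have h10 := hW.root
  rw [sum_insert haW] at h9
  have hpairW : ∀ w ∈ W, w ≠ j → G.Adj a w ∨ G.Adj b w → ¬ Matchable G (W \ {j, w}) →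
      yW a + yW w ≤ 0 := by
    intro w hw hwj hadj hnm
    refine hW.pair a ham w (hm w hw hwj) ((collapse_adj_left (hWa w hw)).2 hadj) fun hmm => hnm ?_
    rw [matchable_collapse_iff (by simp)] at hmm
    exact hmm.congr (by grind)
  have htriW : ∀ p ∈ W, ∀ q ∈ W, p ≠ j → q ≠ j → G.Adj p q → G.Adj a p ∨ G.Adj b p →
      G.Adj a q ∨ G.Adj b q → ¬ Matchable G (W \ {p, q}) → yW a + yW p + yW q ≤ 0 := by
    intro p hp q hq hpj hqj hpq hap haq hnm
    refine hW.triangle a ham p (hm p hp hpj) q (hm q hq hqj)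
      ((collapse_adj_left (hWa p hp)).2 hap) ((collapse_adj (hWa p hp) (hWa q hq)).2 hpq)
      ((collapse_adj_left (hWa q hq)).2 haq) fun hmm => hnm ?_
    rw [matchable_collapse_iff (by simp)] at hmm
    exact hmm.congr (by grind)
  -- Were `W \ {j, w}` matchable, the edge `b w` would let `b` replace `j`; hence the pair formed by
  -- `w` and the merged vertex is flat.
  have hbw : ∀ w ∈ W, w ≠ j → G.Adj b w → yW a + yW w ≤ 0 := by
    intro w hw hwj hadj
    refine hpairW w hw hwj (Or.inr hadj) fun hmm => hb ?_
    refine (matchable_pair hadj).of_parts hmm ?_ ?_ <;> grind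
  -- If `0 ≤ yW a`, the total is at least `2 - max B (yW a) ≥ 1`. If `yW a = -1`, then `W` alone has
  -- total at least 2 and `K` at least 1, which pays for -1 at both attachments.
  obtain ⟨α, β, hα⟩ : ∃ α β : ℤ, (0 ≤ yW a ∧ α = A ∧ β = min B (yW a)) ∨
      (yW a = -1 ∧ α = -1 ∧ β = -1) := by
    by_cases hR : 0 ≤ yW a
    · exact ⟨A, _, Or.inl ⟨hR, rfl, rfl⟩⟩
    · exact ⟨-1, -1, Or.inr ⟨by omega, rfl, rfl⟩⟩
  have hne : ∀ v ∈ C.erase j, v ≠ j := fun v hv => (mem_erase.1 hv).1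
  refine ⟨glue K a b yK α β yW, ?_, ?_, ?_, ?_, ?_, ?_, ?_⟩
  · exact h.le_glue hK.lower (by omega) (by omega) fun w hw => hW.lower w (by simp [hw])
  · exact h.glue_le hK.upper (by omega) (by omega) fun w hw => hW.upper w (by simp [hw])
  · rw [h.glue_rest hj]; exact h10
  · rw [h.sum_glue]; omega
  · intro k hk hadj
    rw [h.glue_rest hj]
    rcases h.cases hk with hk | rfl | rfl | hk
    · exact absurd hadj.symm (h.not_adj hk hj)
    · rw [h.glue_left]; omega
    · rw [h.glue_right]
      have := hW.edge a (by simp) ((collapse_adj_left hja).2 (Or.inr hadj.symm)).symm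
      omega
    · rw [h.glue_rest hk]
      exact hW.edge k (by simp [hk]) ((collapse_adj hja (hWa k hk)).2 hadj)
  · refine h.pairBound_glue (erase_subset _ _) ?_ ?_ ?_ ?_ ?_ ?_ ?_
    · intro p hp q hq _ _ hpq hflat
      exact hK.pair p hp q hq hpq (h.not_matchable_of_flat_rest hj ha hp hq hflat)
    · intro _ k hk _ hadj _
      have := hK.edge k hk a (by simp) h.ne hadj
      have := hK.upper k hk
      omega
    · intro _ k hk _ _ hflat
      exact absurd (h.matchable_sdiff_of_rest hj ha hk) hflat
    · intro _ _
      omega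
    · intro _ w hw hwD hadj hflat
      have := hpairW w hw (hne w hwD) (Or.inl hadj) fun hmm => hflat
        ((h.matchable_sdiff_insert (T := {j, w}) (by simp [insert_subset_iff, hj, hw]) hmm).congr (by grind))
      have := hW.upper w (by simp [hw])
      omega
    · intro _ w hw hwD hadj _
      have := hbw w hw (hne w hwD) hadj
      have := hW.upper w (by simp [hw])
      omega
    · intro p hp q hq hpD hqD hpq hflat
      exact hW.pair p (hm p hp (hne p hpD)) q (hm q hq (hne q hqD))
        ((collapse_adj (hWa p hp) (hWa q hq)).2 hpq) fun hmm =>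
        hflat (h.matchable_of_collapse (by simp [insert_subset_iff, hj, hp, hq]) hmm)
  · refine h.triangleBound_glue (erase_subset _ _) ?_ ?_ ?_ ?_ ?_ ?_ ?_
    · intro p hp q hq r hr _ _ _
      exact hK.triangle p hp q hq r hr
    · intro _ p hp q hq _ _ hpq _ _ hflat
      have := h.pair_left hK hp hq hpq hflat
      omega
    · intro _ p hp q hq _ _ hpq hbp hbq hflat
      have := h.pair_right hK hp hq hpq hbp hbq hflat
      omega
    · intro _ _ w hw hwD _ hadj
      have := hbw w hw (hne w hwD) hadj
      have := hW.upper w (by simp [hw])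
      omega
    · intro _ p hp q hq hpD hqD hpq hap haq hflat
      have := htriW p hp q hq (hne p hpD) (hne q hqD) hpq (Or.inl hap) (Or.inl haq) hflat
      omega
    · intro _ p hp q hq hpD hqD hpq hbp hbq hflat
      have := htriW p hp q hq (hne p hpD) (hne q hqD) hpq (Or.inr hbp) (Or.inr hbq) hflat
      omega
    · intro p hp q hq r hr hpD hqD hrD hpq hqr hpr hflat
      exact hW.triangle p (hm p hp (hne p hpD)) q (hm q hq (hne q hqD)) r (hm r hr (hne r hrD))
        ((collapse_adj (hWa p hp) (hWa q hq)).2 hpq) ((collapse_adj (hWa q hq) (hWa r hr)).2 hqr)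
        ((collapse_adj (hWa p hp) (hWa r hr)).2 hpr) fun hmm =>
          hflat (h.matchable_of_collapse (by simp [insert_subset_iff, hp, hq, hr]) hmm)

theorem exists_rootedWeight_of_notMem (h : TwoEnd G C K W a b)
    (hIH : HasRootedWeights V C.card) {j : V} (hj : j ∈ C) (hjK : j ∉ K) :
    ∃ y, RootedWeight G C j y := by
  rcases h.cases hj with hj | rfl | rfl | hj
  · exact absurd hj hjK
  · exact h.exists_rootedWeight_left hIH
  · exact h.symm.exists_rootedWeight_left hIH
  · by_cases ha : Matchable G (insert a (W.erase j)) <;>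
      by_cases hb : Matchable G (insert b (W.erase j))
    · exact h.exists_rootedWeight_rest_both hIH hj ha hb
    · exact h.exists_rootedWeight_rest_one hIH hj ha hb
    · exact h.symm.exists_rootedWeight_rest_one hIH hj hb ha
    · rcases h.exists_attach hj with h' | h'
      · exact absurd h' ha
      · exact absurd h' hb

/-- A two-vertex attachment gives a weight of total at least two. -/
theorem exists_weight (h : TwoEnd G C K W a b) (hIH : HasRootedWeights V C.card) :
    ∃ y : V → ℤ, (∀ v ∈ C, y v ≤ 1) ∧ 2 ≤ ∑ v ∈ C, y v ∧
      ∀ p ∈ C, ∀ q ∈ C, ∀ r ∈ C, TriangleBound G C y p q r := by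
  obtain ⟨yK, A, B, hK⟩ := h.exists_endValues hIH
  obtain ⟨yW, R, hW⟩ := h.exists_restValues hIH
  have h2 := hK.upper_left; have h5 := hK.add_le; have h6 := hK.total
  have h8 := hW.upper_root; have h9 := hW.total
  -- `K` with `min B 0` and `W` with `R` each contribute at least 1, since `A + B ≤ min B 0`.
  refine ⟨glue K a b yK R (min B 0) yW, ?_, ?_, ?_⟩
  · exact h.glue_le hK.upper (by omega) (by omega) hW.upper
  · rw [h.sum_glue]; omega
  · refine h.triangleBound_glue subset_rfl ?_ ?_ ?_ ?_ ?_ ?_ ?_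
    · intro p hp q hq r hr _ _ _
      exact hK.triangle p hp q hq r hr
    · intro _ p hp q hq _ _ hpq _ _ hflat
      have := h.pair_left hK hp hq hpq hflat
      omega
    · intro _ p hp q hq _ _ hpq hbp hbq hflat
      have := h.pair_right hK hp hq hpq hbp hbq hflat
      omega
    · intro _ _ w hw _ haw _
      have := hW.edge w hw (Or.inl haw)
      omega
    · intro _ p hp q hq _ _ hpq _ _ hflat
      have := hW.pair p hp q hq hpq hflat
      omega
    · intro _ p hp q hq _ _ hpq _ _ hflat
      have := hW.pair p hp q hq hpq hflat
      omega
    · intro p hp q hq r hr _ _ _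
      exact hW.triangle p hp q hq r hr

end TwoEnd

/-- Two attachments supply `a` and `b`; the third makes `C` larger than `K` by more than two, so the
induction hypothesis applies. -/
lemma IsEnd.exists_endWeight_of_three_le {C K X : Finset V} (h : IsEnd G C K X)
    (hIH : HasRootedWeights V C.card) (h3 : 3 ≤ (nbr G X {K}).card) {b : V}
    (hb : b ∈ nbr G X {K}) : ∃ z, EndWeight G C K X b z := by
  have hadj : ∀ x ∈ nbr G X {K}, x ∈ X ∧ ∃ k ∈ K, G.Adj x k := by
    intro x hx
    obtain ⟨hxX, L, hL, h⟩ := mem_nbr.1 hx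
    rw [mem_singleton.1 hL] at h
    exact ⟨hxX, h⟩
  obtain ⟨a, ha, hab⟩ := exists_mem_ne (by omega : 1 < (nbr G X {K}).card) b
  have hlt : K.card + 2 < C.card := by
    have h1 : Disjoint K (nbr G X {K}) := by
      rw [disjoint_left]
      exact fun v hv hv' => h.notMem v (nbr_subset hv') hv
    have h2 := card_le_card (union_subset h.sub (nbr_subset.trans h.subset) :
      K ∪ nbr G X {K} ⊆ C)
    rw [card_union_of_disjoint h1] at h2
    omega
  exact h.exists_endWeight hIH hlt (hadj a ha).1 (hadj b hb).1 hab (hadj b hb).2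
    ⟨a, (hadj a ha).1, hab, (hadj a ha).2⟩

/-! ### Two ends with at least three attachments each. -/

/-- Two ends with common attachments. -/
structure TwoEnds (G : SimpleGraph V) (C K₁ K₂ X : Finset V) : Prop where
  left : IsEnd G C K₁ X
  right : IsEnd G C K₂ X
  disj : Disjoint K₁ K₂
  card_left : 3 ≤ (nbr G X {K₁}).card
  card_right : 3 ≤ (nbr G X {K₂}).card

namespace TwoEnds

variable {C K₁ K₂ X : Finset V}

/-- The sum of two end weights, lowered at one attachment `g`. -/
lemma exists_weight_lowered (h : TwoEnds G C K₁ K₂ X) (hIH : HasRootedWeights V C.card) {g : V}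
    (hg : g ∈ X) : ∃ (b₁ b₂ : V) (z₁ z₂ z : V → ℤ), b₁ ∈ X ∧ b₂ ∈ X ∧ b₁ ≠ g ∧ b₂ ≠ g ∧
      EndWeight G C K₁ X b₁ z₁ ∧ EndWeight G C K₂ X b₂ z₂ ∧ (∀ v ∈ K₁, z v = z₁ v) ∧
      (∀ v ∈ K₂, z v = z₂ v) ∧ (∀ v, v ∉ K₁ → v ∉ K₂ → z v ≤ 0) ∧ z g = -1 ∧
      (∀ v, -1 ≤ z v) ∧ (∀ v, z v ≤ 1) ∧ 1 ≤ ∑ v ∈ C, z v ∧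
      ∀ p ∈ C, ∀ q ∈ C, ∀ r ∈ C, TriangleBound G C z p q r := by
  obtain ⟨b₁, hb₁, hb₁g⟩ := exists_mem_ne (by have := h.card_left; omega :
    1 < (nbr G X {K₁}).card) g
  -- The third neighbour is needed here: with `b₁`, `b₂` and `g` distinct, no vertex is lowered
  -- twice and all values stay at least -1.
  obtain ⟨b₂, hb₂⟩ : (nbr G X {K₂} \ {g, b₁}).Nonempty := by
    rw [← card_pos]
    have := card_sdiff_pair_ge (A := nbr G X {K₂}) (x := g) (x' := b₁)
    have := h.card_right
    omega
  simp only [mem_sdiff, mem_insert, mem_singleton, not_or] at hb₂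
  obtain ⟨hb₂, hb₂g, hb₂₁⟩ := hb₂
  obtain ⟨z₁, hz₁⟩ := h.left.exists_endWeight_of_three_le hIH h.card_left hb₁
  obtain ⟨z₂, hz₂⟩ := h.right.exists_endWeight_of_three_le hIH h.card_right hb₂
  have hX₁ := h.left.notMem
  have hX₂ := h.right.notMem
  have hb₁X := nbr_subset hb₁
  have hb₂X := nbr_subset hb₂
  have hd : ∀ v ∈ K₁, v ∉ K₂ := fun v hv => disjoint_left.1 h.disj hv
  let e : V → ℤ := fun v => if v = g then -1 else 0
  have he : e g = -1 := by simp [e]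
  have he0 : ∀ v, v ≠ g → e v = 0 := fun v hv => by simp [e, hv]
  have he' : ∀ v, e v ≤ 0 := fun v => by by_cases hv : v = g <;> simp [e, hv]
  have hv₁ : ∀ v ∈ K₁, z₁ v + z₂ v + e v = z₁ v := by
    intro v hv
    have h1 := hz₂.zero v (hd v hv) (by rintro rfl; exact hX₁ v hb₂X hv)
    have h2 := he0 v (by rintro rfl; exact hX₁ v hg hv)
    omega
  have hv₂ : ∀ v ∈ K₂, z₁ v + z₂ v + e v = z₂ v := by
    intro v hv
    have h1 := hz₁.zero v (fun hv' => hd v hv' hv) (by rintro rfl; exact hX₂ v hb₁X hv)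
    have h2 := he0 v (by rintro rfl; exact hX₂ v hg hv)
    omega
  have hnonpos : ∀ v, v ∉ K₁ → v ∉ K₂ → z₁ v + z₂ v + e v ≤ 0 := by
    intro v h1 h2
    have := hz₁.nonpos v h1
    have := hz₂.nonpos v h2
    have := he' v
    omega
  refine ⟨b₁, b₂, z₁, z₂, fun v => z₁ v + z₂ v + e v, hb₁X, hb₂X, hb₁g, hb₂g, hz₁, hz₂, hv₁, hv₂,
    hnonpos, ?_, ?_, ?_, ?_, ?_⟩
  · have h1 := hz₁.zero g (hX₁ g hg) hb₁g.symm
    have h2 := hz₂.zero g (hX₂ g hg) (Ne.symm hb₂g)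
    simp only
    omega
  · intro v
    simp only
    by_cases h1 : v ∈ K₁
    · rw [hv₁ v h1]; exact hz₁.lower v
    by_cases h2 : v ∈ K₂
    · rw [hv₂ v h2]; exact hz₂.lower v
    have l1 := hz₁.lower v
    have l2 := hz₂.lower v
    by_cases hv₁ : v = b₁
    · subst hv₁
      rw [hz₂.zero v h2 (Ne.symm hb₂₁), he0 v hb₁g]; omega
    rw [hz₁.zero v h1 hv₁]
    by_cases hv₂ : v = b₂
    · subst hv₂
      rw [he0 v hb₂g]; omega
    rw [hz₂.zero v h2 hv₂]
    by_cases hvg : v = g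
    · subst hvg; omega
    · rw [he0 v hvg]; omega
  · intro v
    simp only
    by_cases h1 : v ∈ K₁
    · rw [hv₁ v h1]; exact hz₁.upper v
    by_cases h2 : v ∈ K₂
    · rw [hv₂ v h2]; exact hz₂.upper v
    · exact (hnonpos v h1 h2).trans zero_le_one
  · have h1 : ∑ v ∈ C, e v = -1 := by
      simp [e, h.left.subset hg]
    rw [sum_add_distrib, sum_add_distrib, h1]
    have := hz₁.total
    have := hz₂.total
    omega
  · intro p hp q hq r hr hpq hqr hpr hflat
    have h1 := hz₁.triangle p hp q hq r hr hpq hqr hpr hflat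
    have h2 := hz₂.triangle p hp q hq r hr hpq hqr hpr hflat
    have := he' p; have := he' q; have := he' r
    simp only
    omega

/-- The sum of two end weights. -/
lemma exists_weight (h : TwoEnds G C K₁ K₂ X) (hIH : HasRootedWeights V C.card) :
    ∃ y : V → ℤ, (∀ v ∈ C, y v ≤ 1) ∧ 2 ≤ ∑ v ∈ C, y v ∧
      ∀ p ∈ C, ∀ q ∈ C, ∀ r ∈ C, TriangleBound G C y p q r := by
  obtain ⟨b₁, hb₁⟩ := card_pos.1 (by have := h.card_left; omega : 0 < (nbr G X {K₁}).card)
  obtain ⟨b₂, hb₂⟩ := card_pos.1 (by have := h.card_right; omega : 0 < (nbr G X {K₂}).card)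
  obtain ⟨z₁, hz₁⟩ := h.left.exists_endWeight_of_three_le hIH h.card_left hb₁
  obtain ⟨z₂, hz₂⟩ := h.right.exists_endWeight_of_three_le hIH h.card_right hb₂
  refine ⟨fun v => z₁ v + z₂ v, ?_, ?_, ?_⟩
  · intro v _
    have u1 := hz₁.upper v
    have u2 := hz₂.upper v
    simp only
    by_cases h1 : v ∈ K₁
    · have := hz₂.nonpos v (disjoint_left.1 h.disj h1)
      omega
    · have := hz₁.nonpos v h1
      omega
  · rw [sum_add_distrib]
    have := hz₁.total
    have := hz₂.total
    omega
  · intro p hp q hq r hr hpq hqr hpr hflat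
    have h1 := hz₁.triangle p hp q hq r hr hpq hqr hpr hflat
    have h2 := hz₂.triangle p hp q hq r hr hpq hqr hpr hflat
    simp only
    omega

/-- A rooted weight from two ends avoiding the root, when deleting the root and any attachment
other than `g` keeps the complements of the ends matchable. -/
theorem exists_rootedWeight (h : TwoEnds G C K₁ K₂ X) (hIH : HasRootedWeights V C.card) {j g : V}
    (hjC : j ∈ C) (hj₁ : j ∉ K₁) (hj₂ : j ∉ K₂) (hg : g ∈ X) (hm : ∀ x ∈ X, x ≠ g →
      Matchable G ((C \ K₁) \ {j, x}) ∧ Matchable G ((C \ K₂) \ {j, x})) :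
    ∃ y, RootedWeight G C j y := by
  obtain ⟨b₁, b₂, z₁, z₂, z, hb₁, hb₂, hb₁g, hb₂g, hz₁, hz₂, hv₁, hv₂, hnonpos, hzg, hlow, hup,
    htot, htri⟩ := h.exists_weight_lowered hIH hg
  -- For `j ∈ X` other than `g`, the hypothesis with `x = j` would delete a single vertex from the
  -- even set `C \ K₁`.
  have hjg : j ∈ X → j = g := by
    intro hjX
    by_contra hne
    have h1 := (hm j hjX hne).1.even_card
    have h2 := h.left.matchable.even_card
    have hjm : j ∈ C \ K₁ := mem_sdiff.2 ⟨hjC, hj₁⟩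
    rw [pair_eq_singleton, sdiff_singleton_eq_erase, card_erase_of_mem hjm] at h1
    have := card_pos.2 ⟨j, hjm⟩
    obtain ⟨m, hm⟩ := h1; obtain ⟨n, hn⟩ := h2
    omega
  have key : ∀ (K : Finset V) (b : V) (z' : V → ℤ), IsEnd G C K X → b ∈ X → b ≠ g →
      EndWeight G C K X b z' → (∀ v ∈ K, z v = z' v) → j ∉ K →
      (∀ x ∈ X, x ≠ g → Matchable G ((C \ K) \ {j, x})) →
      (∀ q ∈ K, G.Adj j q → j ∈ X) ∧
      ∀ p ∈ K, ∀ q ∈ C.erase j, PairBound G C j z p q := by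
    intro K b z' hK hbX hbg hz' hv hjK hmK
    have hXK := hK.notMem
    have hKC : ∀ v ∈ K, v ∈ C := hK.sub
    refine ⟨fun q hq hadj => (hK.closed q hq j hjC hadj.symm).resolve_left hjK, ?_⟩
    intro p hp q hq hpq hflat
    by_cases hqK : q ∈ K
    · rw [hv p hp, hv q hqK]
      refine hz'.pair p hp q hqK hpq fun k hk hkp hkq hadj hmm => hflat ?_
      have hbj : b ≠ j := by rintro rfl; exact hbg (hjg hbX)
      have hbK := hXK b hbX
      refine hK.matchable_of_cross hk hbX hadj (hmm.congr ?_) ?_ ?_ ((hmK b hbX hbg).congr ?_)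
      · grind
      · grind
      · grind
      · intro v
        simp only [mem_sdiff, mem_insert, mem_singleton]
        grind
    · have hqX := (hK.closed p hp q (mem_erase.1 hq).2 hpq).resolve_left hqK
      -- The value -1 at `g` pays for the one attachment at which a pair may be flat.
      by_cases hqg : q = g
      · subst hqg
        have := hup p
        omega
      · refine absurd ((hK.fc.2 p hp).of_parts (hmK q hqX hqg) ?_ ?_) hflat
        · intro v
          simp only [mem_sdiff, mem_insert, mem_singleton, mem_erase]
          grind
        · grind
  obtain ⟨k₁, k₁'⟩ := key K₁ b₁ z₁ h.left hb₁ hb₁g hz₁ hv₁ hj₁ fun x hx hxg => (hm x hx hxg).1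
  obtain ⟨k₂, k₂'⟩ := key K₂ b₂ z₂ h.right hb₂ hb₂g hz₂ hv₂ hj₂ fun x hx hxg => (hm x hx hxg).2
  have hzj := hnonpos j hj₁ hj₂
  refine ⟨z, fun v _ => hlow v, fun v _ => hup v, hzj, htot, ?_, ?_, ?_⟩
  · intro k hk hadj
    by_cases hX : j ∈ X
    · rw [hjg hX, hzg]
      have := hup k
      omega
    · have := hnonpos k (fun hk' => hX (k₁ k hk' hadj)) (fun hk' => hX (k₂ k hk' hadj))
      omega
  · refine pairBound_of_sorted (fun v => if v ∈ K₁ ∨ v ∈ K₂ then 0 else 1) ?_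
    intro p hp q hq hle
    by_cases h1 : p ∈ K₁
    · exact k₁' p h1 q hq
    by_cases h2 : p ∈ K₂
    · exact k₂' p h2 q hq
    have hq' : ¬ (q ∈ K₁ ∨ q ∈ K₂) := by
      intro hq'
      simp [h1, h2, hq'] at hle
    have := hnonpos p h1 h2
    have := hnonpos q (fun h => hq' (Or.inl h)) (fun h => hq' (Or.inr h))
    intro _ _
    omega
  · intro p hp q hq r hr
    exact htri p (mem_erase.1 hp).2 q (mem_erase.1 hq).2 r (mem_erase.1 hr).2

/-- If `j` is an attachment, lower the sum of both end weights at `j`. Otherwise use an end avoiding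
`j`, to which `j` is not adjacent. -/
theorem exists_rootedWeight_of_matchable (h : TwoEnds G C K₁ K₂ X)
    (hIH : HasRootedWeights V C.card) {j : V} (hj : j ∈ C)
    (hnp : ∀ p ∈ C.erase j, ∀ q ∈ C.erase j, G.Adj p q → Matchable G (C \ {j, p, q})) :
    ∃ y, RootedWeight G C j y := by
  by_cases hjX : j ∈ X
  · obtain ⟨-, -, -, -, z, -, -, -, -, -, -, -, -, -, hzj, hlow, hup, htot, htri⟩ :=
      h.exists_weight_lowered hIH hjX
    refine ⟨z, fun v _ => hlow v, fun v _ => hup v, by omega, htot, ?_, ?_, ?_⟩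
    · intro k _ _
      have := hup k
      omega
    · exact fun p hp q hq hpq hflat => absurd (hnp p hp q hq hpq) hflat
    · intro p hp q hq r hr
      exact htri p (mem_erase.1 hp).2 q (mem_erase.1 hq).2 r (mem_erase.1 hr).2
  have key : ∀ K, IsEnd G C K X → 3 ≤ (nbr G X {K}).card → j ∉ K → ∃ y, RootedWeight G C j y := by
    intro K hK h3 hjK
    obtain ⟨b, hb⟩ := card_pos.1 (by omega : 0 < (nbr G X {K}).card)
    obtain ⟨z, hz⟩ := hK.exists_endWeight_of_three_le hIH h3 hb
    have hzj := hz.nonpos j hjK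
    refine ⟨z, fun v _ => hz.lower v, fun v _ => hz.upper v, hzj, hz.total, ?_, ?_, ?_⟩
    · intro k hk hadj
      have hkK : k ∉ K := fun hkK =>
        hjX ((hK.closed k hkK j hj hadj.symm).resolve_left hjK)
      have := hz.nonpos k hkK
      omega
    · exact fun p hp q hq hpq hflat => absurd (hnp p hp q hq hpq) hflat
    · intro p hp q hq r hr
      exact hz.triangle p (mem_erase.1 hp).2 q (mem_erase.1 hq).2 r (mem_erase.1 hr).2
  by_cases hj₁ : j ∈ K₁
  · exact key K₂ h.right h.card_right (disjoint_left.1 h.disj hj₁)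
  · exact key K₁ h.left h.card_left hj₁

end TwoEnds

/-! ### The induction producing weights. -/

/-- `exists_isEnd` in packaged form. -/
lemma exists_twoEnd_or_twoEnds {C : Finset V} (hC : FactorCritical G C) {u v w : V} (hu : u ∈ C)
    (hv : v ∈ C) (hw : w ∈ C) (huv : G.Adj u v) (huw : u ≠ w) (hvw : v ≠ w)
    (hflat : ¬ Matchable G (C \ {u, v, w})) :
    (∃ K W a b, TwoEnd G C K W a b ∧ w ∉ K) ∨
    (∃ K₁ K₂ X, TwoEnds G C K₁ K₂ X ∧ w ∉ K₁ ∧ w ∉ K₂ ∧ ∃ g ∈ X, ∀ x ∈ X, x ≠ g →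
        Matchable G ((C \ K₁) \ {w, x}) ∧ Matchable G ((C \ K₂) \ {w, x})) := by
  rcases exists_isEnd hC hu hv hw huv huw hvw hflat with
    ⟨K, a, b, h1, h2, h3, h4, h5, h6⟩ | ⟨K₁, K₂, X, h1, h2, h3, h4, h5, h6, h7, h8⟩
  · exact Or.inl ⟨K, _, a, b, ⟨hC, h1, h2, h3, h4, rfl, h6⟩, h5⟩
  · exact Or.inr ⟨K₁, K₂, X, ⟨h1, h2, h3, h4, h5⟩, h6, h7, h8⟩

/-- A pair flat with `j` is used first, since it yields ends avoiding `j`. Without one the pair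
condition is vacuous, and a flat triangle may yield an end containing `j`. -/
lemma FactorCritical.exists_rootedWeight {C : Finset V} (hC : FactorCritical G C)
    (h3 : 3 ≤ C.card) (hIH : HasRootedWeights V C.card) {j : V} (hj : j ∈ C) :
    ∃ y, RootedWeight G C j y := by
  by_cases hp : ∃ p ∈ C.erase j, ∃ q ∈ C.erase j, G.Adj p q ∧ ¬ Matchable G (C \ {j, p, q})
  · obtain ⟨p, hp, q, hq, hpq, hflat⟩ := hp
    rw [mem_erase] at hp hq
    rcases exists_twoEnd_or_twoEnds hC hp.2 hq.2 hj hpq hp.1 hq.1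
      (fun hm => hflat (hm.congr (by grind))) with
      ⟨K, W, a, b, h, hjK⟩ | ⟨K₁, K₂, X, h, h1, h2, g, hg, hm⟩
    · exact h.exists_rootedWeight_of_notMem hIH hj hjK
    · exact h.exists_rootedWeight hIH hj h1 h2 hg hm
  push Not at hp
  by_cases ht : ∃ p ∈ C.erase j, ∃ q ∈ C.erase j, ∃ r ∈ C.erase j, G.Adj p q ∧ G.Adj q r ∧
      G.Adj p r ∧ ¬ Matchable G (C \ {p, q, r})
  · obtain ⟨p, hp', q, hq, r, hr, hpq, hqr, hpr, hflat⟩ := ht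
    rw [mem_erase] at hp' hq hr
    rcases exists_twoEnd_or_twoEnds hC hp'.2 hq.2 hr.2 hpq hpr.ne hqr.ne hflat with
      ⟨K, W, a, b, h, -⟩ | ⟨K₁, K₂, X, h, -⟩
    · by_cases hjK : j ∈ K
      · exact h.exists_rootedWeight_of_mem hIH hjK hp
      · exact h.exists_rootedWeight_of_notMem hIH hj hjK
    · exact h.exists_rootedWeight_of_matchable hIH hj hp
  push Not at ht
  -- The total is `|C| - 2`, which is at least 1.
  refine ⟨fun v => if v = j then -1 else 1, ?_, ?_, ?_, ?_, ?_, ?_, ?_⟩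
  · intro v _; split_ifs <;> omega
  · intro v _; split_ifs <;> omega
  · simp
  · rw [← add_sum_erase _ _ hj, sum_congr rfl (g := fun _ => (1 : ℤ))
      (fun v hv => if_neg (mem_erase.1 hv).1), sum_const, card_erase_of_mem hj]
    simp
    omega
  · intro k _ hadj
    simp [hadj.ne']
  · exact fun p hp' q hq hpq hflat => absurd (hp p hp' q hq hpq) hflat
  · exact fun p hp' q hq r hr hpq hqr hpr hflat => absurd (ht p hp' q hq r hr hpq hqr hpr) hflat

theorem hasRootedWeights (n : ℕ) : HasRootedWeights V n := by
  induction n with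
  | zero => intro G U j h; omega
  | succ n ih =>
    intro G U j hlt hU h3 hj
    rcases Nat.lt_succ_iff_lt_or_eq.1 hlt with h | h
    · exact ih G U j h hU h3 hj
    · subst h
      exact hU.exists_rootedWeight h3 ih hj

/-- A factor-critical set with at least three vertices carries a weight, at most one at every
vertex and of total at least two, that is nonpositive on every triangle whose deletion leaves an
unmatchable set. -/
theorem FactorCritical.exists_weight {C : Finset V} (hC : FactorCritical G C) (h3 : 3 ≤ C.card) :
    ∃ y : V → ℤ, (∀ v ∈ C, y v ≤ 1) ∧ 2 ≤ ∑ v ∈ C, y v ∧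
      ∀ p ∈ C, ∀ q ∈ C, ∀ r ∈ C, TriangleBound G C y p q r := by
  have hIH := hasRootedWeights (V := V) C.card
  by_cases ht : ∃ p ∈ C, ∃ q ∈ C, ∃ r ∈ C, G.Adj p q ∧ G.Adj q r ∧ G.Adj p r ∧
      ¬ Matchable G (C \ {p, q, r})
  · obtain ⟨p, hp, q, hq, r, hr, hpq, hqr, hpr, hflat⟩ := ht
    rcases exists_twoEnd_or_twoEnds hC hp hq hr hpq hpr.ne hqr.ne hflat with
      ⟨K, W, a, b, h, -⟩ | ⟨K₁, K₂, X, h, -⟩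
    · exact h.exists_weight hIH
    · exact h.exists_weight hIH
  push Not at ht
  refine ⟨fun _ => 1, fun _ _ => le_rfl, ?_, ?_⟩
  · simp; omega
  · exact fun p hp q hq r hr hpq hqr hpr hflat => absurd (ht p hp q hq r hr hpq hqr hpr) hflat

end graph

/-! ### A barrier of largest surplus. -/

section barrier

variable {V : Type*} [Fintype V] [DecidableEq V]

/-- A barrier whose members are factor-critical, that covers everything, and that has the largest
surplus. -/
theorem exists_max_barrier (G : SimpleGraph V) : ∃ S 𝒦, Barrier G univ S 𝒦 ∧
    (∀ K ∈ 𝒦, FactorCritical G K) ∧ (∀ v, v ∈ S ∨ ∃ K ∈ 𝒦, v ∈ K) ∧ S.card ≤ 𝒦.card ∧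
    ∀ S' 𝒦', Barrier G univ S' 𝒦' → 𝒦'.card + S.card ≤ 𝒦.card + S'.card := by
  classical
  have hb : ∀ S : Finset V, S.card ≤ Fintype.card V := fun S => card_le_univ S
  -- Adding `Fintype.card V` keeps the surplus in `ℕ`; the subtraction never truncates.
  obtain ⟨p₁, hp₁, hmax₁⟩ := exists_maximal_of_bounded
    (P := fun p : Finset V × Finset (Finset V) => Barrier G univ p.1 p.2)
    (fun p => p.2.card + (Fintype.card V - p.1.card))
    (Fintype.card (Finset V) + Fintype.card V)
    (fun p _ => add_le_add (card_le_univ _) (Nat.sub_le _ _)) ⟨(∅, ∅), barrier_empty⟩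
  obtain ⟨⟨S, 𝒦⟩, ⟨hB, hsup⟩, hmax⟩ := exists_maximal_of_bounded
    (P := fun p : Finset V × Finset (Finset V) => Barrier G univ p.1 p.2 ∧
      p₁.2.card + p.1.card ≤ p.2.card + p₁.1.card)
    (fun p => p.1.card) (Fintype.card V) (fun p _ => hb _) ⟨p₁, hp₁, le_rfl⟩
  simp only at hB hsup
  have hbest : ∀ S' 𝒦', Barrier G univ S' 𝒦' → 𝒦'.card + S.card ≤ 𝒦.card + S'.card := by
    intro S' 𝒦' h
    have h1 := hmax₁ (S', 𝒦') h
    have h2 := hb S'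
    have h3 := hb p₁.1
    simp only at h1
    omega
  have hlarge : ∀ S' 𝒦', Barrier G univ S' 𝒦' → 𝒦.card + S'.card ≤ 𝒦'.card + S.card →
      S'.card ≤ S.card := by
    intro S' 𝒦' h h'
    exact hmax (S', 𝒦') ⟨h, by simp only; omega⟩
  refine ⟨S, 𝒦, hB, ?_, ?_, ?_, hbest⟩
  · intro K hK
    refine ⟨hB.nonempty hK, fun k hk => ?_⟩
    by_contra hnm
    obtain ⟨S', 𝒦', h', hc⟩ := exists_barrier_of_not_matchable _ (by
      obtain ⟨a, ha⟩ := hB.odd K hK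
      rw [card_erase_of_mem hk]; exact ⟨a, by omega⟩) hnm
    have h1 := hB.refine hK hk h'
    have h2 := hB.card_refine_left hK hk h'
    have h3 := hB.card_refine_right hK h'
    have h4 := hlarge _ _ h1 (by omega)
    omega
  -- Largest surplus makes the remainder even. Moving `v` into `S` makes it odd, and adding it as a
  -- member keeps the surplus with larger `S`.
  · by_contra hcon
    push Not at hcon
    obtain ⟨v, hvS, hvK⟩ := hcon
    have hodd : ¬ Odd (Barrier.rest univ S 𝒦).card := by
      intro hodd
      have h1 := hbest _ _ (hB.add_rest hodd)
      rw [Barrier.card_add_rest hodd] at h1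
      omega
    have hB' : Barrier G univ (insert v S) 𝒦 := hB.enlarge (subset_insert _ _)
      (subset_univ _) (by
        intro K hK k hk hmem
        rcases mem_insert.1 hmem with rfl | hmem
        · exact hvK K hK hk
        · exact hB.notMem K hK k hk hmem)
    have hodd' : Odd (Barrier.rest univ (insert v S) 𝒦).card := by
      have h1 := hB'.even_card_add
      have h2 := hB.even_card_add
      rw [card_insert_of_notMem hvS] at h1
      rw [Nat.not_odd_iff_even] at hodd
      rw [← Nat.not_even_iff_odd]
      intro hev
      obtain ⟨a, ha⟩ := h1; obtain ⟨b, hb⟩ := hev; obtain ⟨c, hc⟩ := hodd; obtain ⟨d, hd⟩ := h2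
      omega
    have h1 := hlarge _ _ (hB'.add_rest hodd') (by
      rw [Barrier.card_add_rest hodd', card_insert_of_notMem hvS]; omega)
    rw [card_insert_of_notMem hvS] at h1
    omega
  · have := hbest ∅ ∅ barrier_empty
    simpa using this

end barrier

/-! ### Extended matchings, bad sets and the degree count. -/

section hypergraph

variable {V E : Type*} [DecidableEq V] (H : MultiHypergraph V E)

/-- Two nodes are adjacent if they lie in a common hyperedge. -/
def coGraph : SimpleGraph V :=
  SimpleGraph.fromRel fun u v => ∃ e, u ∈ H.edge e ∧ v ∈ H.edge e

variable {H}

lemma coGraph_adj {u v : V} :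
    (coGraph H).Adj u v ↔ u ≠ v ∧ ∃ e, u ∈ H.edge e ∧ v ∈ H.edge e := by
  simp only [coGraph, SimpleGraph.fromRel_adj]
  constructor
  · rintro ⟨h, h' | ⟨e, h1, h2⟩⟩
    · exact ⟨h, h'⟩
    · exact ⟨h, e, h2, h1⟩
  · rintro ⟨h, h'⟩
    exact ⟨h, Or.inl h'⟩

/-- An extended matching inside `U` covers all nodes of `U` in `T`. -/
def Packed (H : MultiHypergraph V E) (T : Set V) (U : Finset V) : Prop :=
  ∃ M : Finset (Finset V), H.IsExtendedMatching M ∧ (∀ s ∈ M, s ⊆ U) ∧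
    ∀ v ∈ U, v ∈ T → ∃ s ∈ M, v ∈ s

variable {T : Set V}

lemma Packed.biUnion {ι : Type*} {s : Finset ι} {t : ι → Finset V}
    (h : ∀ i ∈ s, Packed H T (t i)) (hd : (s : Set ι).PairwiseDisjoint t) :
    Packed H T (s.biUnion t) := by
  classical
  choose! M h1 h2 h3 using h
  refine ⟨s.biUnion M, ⟨?_, ?_⟩, ?_, ?_⟩
  · intro u hu
    obtain ⟨i, hi, hu⟩ := mem_biUnion.1 hu
    exact (h1 i hi).1 u hu
  · intro u hu v hv hne
    obtain ⟨i, hi, hu⟩ := mem_biUnion.1 (mem_coe.1 hu)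
    obtain ⟨k, hk, hv⟩ := mem_biUnion.1 (mem_coe.1 hv)
    by_cases hik : i = k
    · subst hik
      exact (h1 i hi).2 hu hv hne
    · exact (hd hi hk hik).mono (h2 i hi u hu) (h2 k hk v hv)
  · intro u hu
    obtain ⟨i, hi, hu⟩ := mem_biUnion.1 hu
    exact (h2 i hi u hu).trans (subset_biUnion_of_mem t hi)
  · intro v hv hvT
    obtain ⟨i, hi, hv⟩ := mem_biUnion.1 hv
    obtain ⟨u, hu, hvu⟩ := h3 i hi v hv hvT
    exact ⟨u, mem_biUnion.2 ⟨i, hi, hu⟩, hvu⟩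

lemma Matchable.packed {U : Finset V} (h : Matchable (coGraph H) U) : Packed H T U := by
  obtain ⟨f, hf⟩ := h
  have hmem : ∀ u ∈ U, ∀ v, v ∈ ({u, f u} : Finset V) → v ∈ U ∧ ({v, f v} : Finset V) = {u, f u} := by
    intro u hu v hv
    simp only [mem_insert, mem_singleton] at hv
    rcases hv with rfl | rfl
    · exact ⟨hu, rfl⟩
    · exact ⟨(hf u hu).1, by rw [(hf u hu).2.2, pair_comm]⟩
  refine ⟨U.image fun u => {u, f u}, ⟨?_, ?_⟩, ?_, ?_⟩
  · intro s hs
    obtain ⟨u, hu, rfl⟩ := mem_image.1 hs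
    obtain ⟨hne, e, he⟩ := coGraph_adj.1 (hf u hu).2.1
    exact Or.inr ⟨card_pair hne, e, by simp [insert_subset_iff, he]⟩
  · intro s hs t ht hne
    obtain ⟨u, hu, rfl⟩ := mem_image.1 (mem_coe.1 hs)
    obtain ⟨v, hv, rfl⟩ := mem_image.1 (mem_coe.1 ht)
    rw [disjoint_left]
    intro w hw hw'
    exact hne ((hmem u hu w hw).2.symm.trans (hmem v hv w hw').2)
  · intro s hs
    obtain ⟨u, hu, rfl⟩ := mem_image.1 hs
    exact fun v hv => (hmem u hu v hv).1
  · intro v hv _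
    exact ⟨{v, f v}, mem_image.2 ⟨v, hv, rfl⟩, by simp⟩

lemma Packed.of_erase {U : Finset V} {v : V} (hv : v ∉ T) (h : Packed H T (U.erase v)) :
    Packed H T U := by
  obtain ⟨M, h1, h2, h3⟩ := h
  refine ⟨M, h1, fun s hs => (h2 s hs).trans (erase_subset _ _), fun u hu huT => ?_⟩
  exact h3 u (mem_erase.2 ⟨by rintro rfl; exact hv huT, hu⟩) huT

lemma Packed.of_edge {U : Finset V} {e : E} (he : H.edge e ⊆ U)
    (h : Packed H T (U \ H.edge e)) : Packed H T U := by
  obtain ⟨M, ⟨h1, h1'⟩, h2, h3⟩ := h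
  have hd : ∀ s ∈ M, Disjoint s (H.edge e) := fun s hs => disjoint_sdiff_self_left.mono_left (h2 s hs)
  refine ⟨insert (H.edge e) M, ⟨?_, ?_⟩, ?_, ?_⟩
  · intro s hs
    rcases mem_insert.1 hs with rfl | hs
    · exact Or.inl ⟨e, rfl⟩
    · exact h1 s hs
  · intro s hs t ht hne
    rcases mem_insert.1 (mem_coe.1 hs) with rfl | hs <;>
      rcases mem_insert.1 (mem_coe.1 ht) with rfl | ht
    · exact absurd rfl hne
    · exact (hd t ht).symm
    · exact hd s hs
    · exact h1' hs ht hne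
  · intro s hs
    rcases mem_insert.1 hs with rfl | hs
    · exact he
    · exact (h2 s hs).trans sdiff_subset
  · intro v hv hvT
    by_cases hve : v ∈ H.edge e
    · exact ⟨_, mem_insert_self _ _, hve⟩
    · obtain ⟨s, hs, hvs⟩ := h3 v (mem_sdiff.2 ⟨hv, hve⟩) hvT
      exact ⟨s, mem_insert_of_mem hs, hvs⟩

variable [Fintype E]

/-- A set inside `T` with no hyperedge whose deletion leaves a matchable set. -/
def IsBad (H : MultiHypergraph V E) (T : Set V) (K : Finset V) : Prop :=
  (∀ v ∈ K, v ∈ T) ∧ ∀ e, H.edge e ⊆ K → ¬ Matchable (coGraph H) (K \ H.edge e)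

/-- Either a node outside `T` is left uncovered, or a hyperedge is used and the rest of `K` is
matched. -/
lemma packed_of_not_isBad {K : Finset V} (hK : FactorCritical (coGraph H) K)
    (h : ¬ IsBad H T K) : Packed H T K := by
  rw [IsBad, not_and_or] at h
  push Not at h
  rcases h with ⟨v, hv, hvT⟩ | ⟨e, he, hm⟩
  · exact (hK.2 v hv).packed.of_erase hvT
  · exact Packed.of_edge he hm.packed

/-- The number of incidences outside `K` of the hyperedges meeting `K`. -/
def cost (H : MultiHypergraph V E) (K : Finset V) : ℕ :=
  ∑ e, if (H.edge e ∩ K).Nonempty then (H.edge e \ K).card else 0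

lemma degree_eq_sum (v : V) : H.degree v = ∑ e, if v ∈ H.edge e then 1 else 0 := by
  rw [MultiHypergraph.degree, card_filter]

lemma sum_mul_degree (y : V → ℤ) (K : Finset V) :
    ∑ v ∈ K, y v * (H.degree v : ℤ) = ∑ e, ∑ v ∈ H.edge e ∩ K, y v := by
  have h1 : ∀ v, y v * (H.degree v : ℤ) = ∑ e, if v ∈ H.edge e then y v else 0 := by
    intro v
    rw [degree_eq_sum]
    push_cast
    rw [mul_sum]
    exact sum_congr rfl fun e _ => by split_ifs <;> simp
  rw [sum_congr rfl fun v _ => h1 v, sum_comm]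
  refine sum_congr rfl fun e _ => ?_
  rw [← sum_filter]
  congr 1
  ext v; simp [and_comm]

/-- Weighted double counting of incidences against the weight of `FactorCritical.exists_weight`. -/
lemma le_cost_of_isBad (hH : H.IsUniform 3) {Δ : ℕ} (hΔ : ∀ v ∈ T, H.degree v = Δ)
    {K : Finset V} (hK : FactorCritical (coGraph H) K) (hbad : IsBad H T K) : Δ ≤ cost H K := by
  have hdeg : ∀ v ∈ K, H.degree v = Δ := fun v hv => hΔ v (hbad.1 v hv)
  have hsplit : ∀ e, (H.edge e ∩ K).card + (H.edge e \ K).card = 3 := fun e => by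
    rw [card_inter_add_card_sdiff, hH e]
  rcases Nat.lt_or_ge K.card 3 with h3 | h3
  · have h1 : K.card = 1 := by obtain ⟨m, hm⟩ := hK.odd_card; omega
    obtain ⟨v, rfl⟩ := card_eq_one.1 h1
    -- For a single node, each hyperedge through it has two nodes outside.
    rw [← hdeg v (by simp), degree_eq_sum, cost]
    refine sum_le_sum fun e _ => ?_
    by_cases hv : v ∈ H.edge e
    · have hi : H.edge e ∩ {v} = {v} := inter_eq_right.2 (by simpa using hv)
      have := hsplit e
      rw [hi, card_singleton] at this
      rw [hi, if_pos hv, if_pos (singleton_nonempty v)]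
      omega
    · simp [hv]
  · obtain ⟨y, hy1, hy2, hy3⟩ := hK.exists_weight h3
    have hsum : ∑ v ∈ K, y v * (H.degree v : ℤ) = (∑ v ∈ K, y v) * Δ := by
      rw [sum_mul]
      exact sum_congr rfl fun v hv => by rw [hdeg v hv]
    -- Hyperedges inside `K` are flat triangles since `K` is bad. Any other one meeting `K` has
    -- weight at most 2 with one node outside, or at most 1 with two.
    have hle : ∑ e, ∑ v ∈ H.edge e ∩ K, y v ≤ 2 * (cost H K : ℤ) := by
      rw [cost]
      push_cast
      rw [mul_sum]
      refine sum_le_sum fun e _ => ?_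
      by_cases hne : (H.edge e ∩ K).Nonempty
      swap
      · rw [not_nonempty_iff_eq_empty.1 hne]; simp
      rw [if_pos hne]
      by_cases hsub : H.edge e ⊆ K
      · rw [inter_eq_left.2 hsub]
        obtain ⟨p, q, r, hpq, hpr, hqr, he⟩ := card_eq_three.1 (hH e)
        have hflat := hbad.2 e hsub
        have hadj : ∀ u ∈ H.edge e, ∀ v ∈ H.edge e, u ≠ v → (coGraph H).Adj u v :=
          fun u hu v hv huv => coGraph_adj.2 ⟨huv, e, hu, hv⟩
        have hp : p ∈ H.edge e := by simp [he]
        have hq : q ∈ H.edge e := by simp [he]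
        have hr : r ∈ H.edge e := by simp [he]
        have h1 := hy3 p (hsub hp) q (hsub hq) r (hsub hr) (hadj p hp q hq hpq)
          (hadj q hq r hr hqr) (hadj p hp r hr hpr) (he ▸ hflat)
        have h2 : ∑ v ∈ H.edge e, y v = y p + y q + y r := by
          rw [he, sum_insert (by simp [hpq, hpr]), sum_pair hqr]; ring
        rw [h2]
        exact h1.trans (by positivity)
      · have h1 : ∑ v ∈ H.edge e ∩ K, y v ≤ ((H.edge e ∩ K).card : ℤ) := by
          have := sum_le_sum (s := H.edge e ∩ K) (f := y) (g := fun _ => (1 : ℤ))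
            fun v hv => hy1 v (mem_inter.1 hv).2
          simpa using this
        have h2 : 0 < (H.edge e \ K).card := card_pos.2 (sdiff_nonempty.2 hsub)
        have h3 := hsplit e
        omega
    rw [← sum_mul_degree, hsum] at hle
    have : (2 : ℤ) * Δ ≤ (∑ v ∈ K, y v) * Δ := mul_le_mul_of_nonneg_right hy2 (by positivity)
    omega

/-- A hyperedge meeting a member has its other nodes in that member or in the neighbourhood, so it
meets no second member. Each counted incidence is thus one with the neighbourhood, counted once. -/
lemma sum_cost_le {C S : Finset V} {𝒦 𝒦' : Finset (Finset V)} (hC : ∀ v, v ∈ C)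
    (hB : Barrier (coGraph H) C S 𝒦) (h𝒦 : 𝒦' ⊆ 𝒦) {Δ : ℕ} (hΔ : ∀ v, H.degree v ≤ Δ) :
    ∑ K ∈ 𝒦', cost H K ≤ Δ * (nbr (coGraph H) S 𝒦').card := by
  classical
  have hcl : ∀ K ∈ 𝒦', ∀ e, (H.edge e ∩ K).Nonempty → ∀ v ∈ H.edge e,
      v ∈ K ∨ v ∈ nbr (coGraph H) S 𝒦' := by
    intro K hK e hne v hv
    obtain ⟨k, hk⟩ := hne
    rw [mem_inter] at hk
    by_cases hvk : v = k
    · subst hvk; exact Or.inl hk.2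
    · exact (hB.restrict h𝒦).closed K hK k hk.2 v (hC v)
        (coGraph_adj.2 ⟨Ne.symm hvk, e, hk.1, hv⟩)
  have h1 : ∑ K ∈ 𝒦', cost H K ≤ ∑ e, (H.edge e ∩ nbr (coGraph H) S 𝒦').card := by
    simp only [cost]
    rw [sum_comm]
    refine sum_le_sum fun e _ => ?_
    by_cases hex : ∃ K ∈ 𝒦', (H.edge e ∩ K).Nonempty
    · obtain ⟨K, hK, hne⟩ := hex
      rw [sum_eq_single_of_mem K hK, if_pos hne]
      · refine card_le_card fun v hv => ?_
        rw [mem_sdiff] at hv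
        exact mem_inter.2 ⟨hv.1, (hcl K hK e hne v hv.1).resolve_left hv.2⟩
      · intro L hL hLK
        refine if_neg fun hneL => hLK ?_
        obtain ⟨l, hl⟩ := hneL
        rw [mem_inter] at hl
        rcases hcl K hK e hne l hl.1 with h | h
        · exact hB.disj L (h𝒦 hL) K (h𝒦 hK) l hl.2 h
        · exact absurd (nbr_subset h) (hB.notMem L (h𝒦 hL) l hl.2)
    · push Not at hex
      rw [sum_eq_zero fun K hK => if_neg (by simpa using hex K hK)]
      exact Nat.zero_le _
  refine h1.trans ?_
  have h2 : ∑ e, (H.edge e ∩ nbr (coGraph H) S 𝒦').card =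
      ∑ v ∈ nbr (coGraph H) S 𝒦', H.degree v := by
    simp only [degree_eq_sum]
    rw [sum_comm]
    refine sum_congr rfl fun e _ => ?_
    rw [← card_filter]
    congr 1
    ext v; simp [and_comm]
  rw [h2, mul_comm]
  exact (sum_le_card_nsmul _ _ Δ fun v _ => hΔ v).trans_eq (by simp)

theorem packed_univ [Fintype V] (hH : H.IsUniform 3) {Δ : ℕ} (hpos : 0 < Δ)
    (hle : ∀ v, H.degree v ≤ Δ) (hΔ : ∀ v ∈ T, H.degree v = Δ) : Packed H T univ := by
  classical
  obtain ⟨S, 𝒦, hB, hFC, hcov, hcard, hbest⟩ := exists_max_barrier (coGraph H)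
  have hall : ∀ 𝒦' ⊆ 𝒦, (∀ K ∈ 𝒦', IsBad H T K) →
      𝒦'.card ≤ (nbr (coGraph H) S 𝒦').card := by
    intro 𝒦' h𝒦' hbad
    have h1 : 𝒦'.card * Δ ≤ ∑ K ∈ 𝒦', cost H K := by
      have := card_nsmul_le_sum 𝒦' (cost H) Δ fun K hK =>
        le_cost_of_isBad hH hΔ (hFC K (h𝒦' hK)) (hbad K hK)
      simpa using this
    have h2 := h1.trans (sum_cost_le mem_univ hB h𝒦' hle)
    rw [mul_comm] at h2
    exact Nat.le_of_mul_le_mul_left h2 hpos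
  -- With `d` dummies there are as many targets as members, so an injective choice is onto and every
  -- node of `S` is used. Only members that are not bad may take a dummy.
  let d := 𝒦.card - S.card
  let dummies : Finset V → Finset (Fin d) := fun K => if IsBad H T K then ∅ else univ
  obtain ⟨φ, hφ, hφ'⟩ := (Finset.all_card_le_biUnion_card_iff_exists_injective
    (fun K : {K // K ∈ 𝒦} => (nbr (coGraph H) S {K.1}).disjSum (dummies K.1))).1 (by
      intro s
      let 𝒦' : Finset (Finset V) := s.map (Function.Embedding.subtype _)
      have hmem : ∀ K, K ∈ 𝒦' ↔ ∃ L ∈ s, L.1 = K := by simp [𝒦']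
      have h𝒦' : 𝒦' ⊆ 𝒦 := by
        intro K hK
        obtain ⟨L, -, rfl⟩ := (hmem K).1 hK
        exact L.2
      have hc : s.card = 𝒦'.card := (card_map _).symm
      have hl : ∀ v ∈ nbr (coGraph H) S 𝒦', (Sum.inl v : V ⊕ Fin d) ∈ s.biUnion fun K =>
          (nbr (coGraph H) S {K.1}).disjSum (dummies K.1) := by
        intro v hv
        obtain ⟨hvS, K, hK, k, hk, hadj⟩ := mem_nbr.1 hv
        obtain ⟨L, hL, rfl⟩ := (hmem K).1 hK
        exact mem_biUnion.2 ⟨L, hL, inl_mem_disjSum.2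
          (mem_nbr.2 ⟨hvS, L, mem_singleton_self _, k, hk, hadj⟩)⟩
      by_cases hbad : ∀ K ∈ 𝒦', IsBad H T K
      · rw [hc]
        refine (hall 𝒦' h𝒦' hbad).trans ?_
        rw [← card_map (Function.Embedding.inl : V ↪ V ⊕ Fin d)]
        refine card_le_card fun x hx => ?_
        obtain ⟨v, hv, rfl⟩ := mem_map.1 hx
        exact hl v hv
      · push Not at hbad
        obtain ⟨K, hK, hgood⟩ := hbad
        obtain ⟨L, hL, rfl⟩ := (hmem K).1 hK
        -- A family with a member that is not bad has access to all dummies; its surplus is at most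
        -- `d` because the barrier has largest surplus.
        have h1 := hbest _ _ (hB.restrict h𝒦')
        have h2 : ((nbr (coGraph H) S 𝒦').disjSum (univ : Finset (Fin d))).card =
            (nbr (coGraph H) S 𝒦').card + d := by rw [card_disjSum]; simp
        refine le_trans ?_ (card_le_card (s := (nbr (coGraph H) S 𝒦').disjSum
          (univ : Finset (Fin d))) ?_)
        · rw [h2, hc]; omega
        · intro x hx
          rcases mem_disjSum.1 hx with ⟨v, hv, rfl⟩ | ⟨i, -, rfl⟩
          · exact hl v hv
          · exact mem_biUnion.2 ⟨L, hL, inr_mem_disjSum.2 (by simp [dummies, hgood])⟩)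
  have hsurj : ∀ s ∈ S, ∃ K, φ K = Sum.inl s := by
    have himg : 𝒦.attach.image φ = S.disjSum (univ : Finset (Fin d)) := by
      refine eq_of_subset_of_card_le ?_ ?_
      · intro x hx
        obtain ⟨K, -, rfl⟩ := mem_image.1 hx
        exact disjSum_mono nbr_subset (subset_univ _) (hφ' K)
      · rw [card_image_of_injective _ hφ, card_attach, card_disjSum]
        simp only [card_univ, Fintype.card_fin, d]
        omega
    intro s hs
    have : (Sum.inl s : V ⊕ Fin d) ∈ 𝒦.attach.image φ := by
      rw [himg]; exact inl_mem_disjSum.2 hs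
    obtain ⟨K, -, hK⟩ := mem_image.1 this
    exact ⟨K, hK⟩
  have hφS : ∀ K s, φ K = Sum.inl s → s ∈ S ∧ ∃ k ∈ K.1, (coGraph H).Adj s k := by
    intro K s hKs
    have h1 := hφ' K
    rw [hKs, inl_mem_disjSum] at h1
    obtain ⟨h2, L, hL, h3⟩ := mem_nbr.1 h1
    rw [mem_singleton.1 hL] at h3
    exact ⟨h2, h3⟩
  let piece : {K // K ∈ 𝒦} → Finset V := fun K => K.1 ∪ univ.filter fun s => φ K = Sum.inl s
  have hpiece : ∀ K v, v ∈ piece K ↔ v ∈ K.1 ∨ φ K = Sum.inl v := by simp [piece]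
  have hpacked : Packed H T (𝒦.attach.biUnion piece) := by
    refine Packed.biUnion ?_ ?_
    · intro K _
      rcases hK : φ K with s | i
      · obtain ⟨hs, k, hk, hadj⟩ := hφS K s hK
        have := (hFC K.1 K.2).matchable_insert (fun h => hB.notMem K.1 K.2 s h hs) hk hadj
        refine (this.congr fun v => ?_).packed
        rw [hpiece, hK, mem_insert, Sum.inl.injEq]
        tauto
      · have h1 := hφ' K
        rw [hK, inr_mem_disjSum] at h1
        have hgood : ¬ IsBad H T K.1 := fun hbad => by simp [dummies, hbad] at h1
        have h2 := packed_of_not_isBad (hFC K.1 K.2) hgood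
        have h3 : piece K = K.1 := by
          ext v; rw [hpiece, hK]; simp
        rwa [h3]
    · intro K _ L _ hne
      rw [Function.onFun, disjoint_left]
      intro v hvK hvL
      rw [hpiece] at hvK hvL
      rcases hvK with hvK | hvK <;> rcases hvL with hvL | hvL
      · exact hne (Subtype.ext (hB.disj K.1 K.2 L.1 L.2 v hvK hvL))
      · exact hB.notMem K.1 K.2 v hvK (hφS L v hvL).1
      · exact hB.notMem L.1 L.2 v hvL (hφS K v hvK).1
      · exact hne (hφ (hvK.trans hvL.symm))
  have huniv : 𝒦.attach.biUnion piece = univ := by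
    refine eq_univ_of_forall fun v => mem_biUnion.2 ?_
    rcases hcov v with hv | ⟨K, hK, hv⟩
    · obtain ⟨K, hK⟩ := hsurj v hv
      exact ⟨K, mem_attach _ _, (hpiece K v).2 (Or.inr hK)⟩
    · exact ⟨⟨K, hK⟩, mem_attach _ _, (hpiece _ v).2 (Or.inl hv)⟩
  rwa [huniv] at hpacked

end hypergraph

end ExtendedMatching

theorem mainTheorem3 {V E : Type*} [Fintype V] [DecidableEq V] [Fintype E] [Nonempty E]
    (H : MultiHypergraph V E) (hH : H.IsUniform 3) :
    ∃ M : Finset (Finset V), H.IsExtendedMatching M ∧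
      ∀ v, H.IsMaxDegree v → ∃ s ∈ M, v ∈ s := by
  obtain ⟨e⟩ := ‹Nonempty E›
  obtain ⟨u, hu⟩ := Finset.card_pos.1 (by rw [hH e]; norm_num : 0 < (H.edge e).card)
  obtain ⟨m, -, hm⟩ := Finset.exists_max_image Finset.univ H.degree ⟨u, Finset.mem_univ u⟩
  have hmax : ∀ v, H.degree v ≤ H.degree m := fun v => hm v (Finset.mem_univ v)
  have hpos : 0 < H.degree m :=
    (Finset.card_pos.2 ⟨e, by simp [hu]⟩ : 0 < H.degree u).trans_le (hmax u)
  obtain ⟨M, h1, -, h3⟩ := ExtendedMatching.packed_univ (T := {v | H.IsMaxDegree v}) hH hpos hmax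
    fun v hv => le_antisymm (hmax v) (hv m)
  exact ⟨M, h1, fun v hv => h3 v (Finset.mem_univ v) hv⟩
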